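/- **Corollary (gap forcing creates no new weakly compact cardinals).** Let $\mathbb R$ be a forcing notion and let $\kappa$ be an ordinal. Suppose that $\mathbb R$ admits a gap below $\kappa$; that is, for some cardinal $\delta<\kappa$, the forcing $\mathbb R$ factors, up to isomorphism of Boolean completions, as a two-step iteration $\mathbb P*\dot{\mathbb Q}$, where $\mathbb P$ is nontrivial (below every condition there are two incompatible conditions), $|\mathbb P|<\delta$, and $\Vdash_{\mathbb P}$ "$\dot{\mathbb Q}$ is ${\leq}\delta$-strategically closed". If $\kappa$ is weakly compact in a forcing extension $V[G]$ by $\mathbb R$ (equivalently, if some condition $r\in\mathbb R$ forces that $\check\kappa$ is weakly compact), then $\kappa$ is weakly compact in the ground model $V$. Here a forcing notion is a nonempty preorder. It is *${\leq}\delta$-strategically closed* if the second player has a winning strategy in the game in which two players alternately play conditions to build a descending sequence of length $\delta+1$, the first player moving at stage $0$ and the second player moving at all limit stages; her strategy must give her a legal move at each of her stages $\alpha\leq\delta$. A cardinal $\kappa$ is *weakly compact* if it is (strongly) inaccessible and has the tree property: every tree of height $\kappa$ all of whose levels have size less than $\kappa$ has a branch that meets every level. -/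

import Mathlib

universe u v w

namespace GapForcing

/-! ### Boolean-valued structures for the language of set theory

A formula of set theory is written once, as an element of a complete Boolean algebra `B`, for an
arbitrary `B`-valued structure `M`.  For `B = Prop` and `M = ZFSet` this is truth in the universe
`V`; for `M` the Boolean-valued universe `V^B` it is the Boolean value of the formula in the
forcing extension. -/

/-- A `B`-valued interpretation of membership and equality on `M`. -/
class BVal (B : outParam (Type v)) (M : Type w) where
  mem : M → M → B
  eq : M → M → B

infix:75 "∈ᴮ" => BVal.mem
infix:75 "≈ᴮ" => BVal.eq

section Formulas

variable {B : Type v} {M : Type w} [CompleteBooleanAlgebra B] [BVal B M]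

/-- `a ↔ b` -/
def iffB (a b : B) : B := (a ⇨ b) ⊓ (b ⇨ a)

/-- `∀ x ∈ a, φ x` -/
def allIn (a : M) (φ : M → B) : B := ⨅ x : M, x ∈ᴮ a ⇨ φ x

/-- `∃ x ∈ a, φ x` -/
def exIn (a : M) (φ : M → B) : B := ⨆ x : M, x ∈ᴮ a ⊓ φ x

/-- `x ⊆ y` -/
def subsetB (x y : M) : B := allIn x fun z => z ∈ᴮ y

/-- `x = ∅` -/
def isEmptyB (x : M) : B := ⨅ y : M, (y ∈ᴮ x)ᶜ

/-- `z = {x, y}` -/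
def isUPair (z x y : M) : B := ⨅ t : M, iffB (t ∈ᴮ z) (t ≈ᴮ x ⊔ t ≈ᴮ y)

/-- `z = (x, y)`, the Kuratowski pair `{{x}, {x, y}}` -/
def isPair (z x y : M) : B := ⨆ a : M, ⨆ b : M, isUPair a x x ⊓ isUPair b x y ⊓ isUPair z a b

/-- `(x, y) ∈ R` -/
def relB (R x y : M) : B := exIn R fun z => isPair z x y

/-- `R ⊆ A × C` -/
def isRelation (R A C : M) : B := allIn R fun z => exIn A fun x => exIn C fun y => isPair z x y

/-- `f : A → C` -/
def isFunction (f A C : M) : B :=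
  isRelation f A C ⊓
    allIn A fun x => exIn C fun y => relB f x y ⊓ allIn C fun y' => relB f x y' ⇨ y' ≈ᴮ y

/-- `f : A → C` is injective -/
def isInjection (f A C : M) : B :=
  isFunction f A C ⊓
    allIn A fun x => allIn A fun x' => allIn C fun y => relB f x y ⊓ relB f x' y ⇨ x ≈ᴮ x'

/-- `p` is the power set of `x` -/
def isPowerset (p x : M) : B := ⨅ z : M, iffB (z ∈ᴮ p) (subsetB z x)

/-- `x` is a transitive set -/
def isTransitive (x : M) : B := allIn x fun y => subsetB y x

/-- `x` is an ordinal: a transitive set of transitive sets -/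
def isOrdinal (x : M) : B := isTransitive x ⊓ allIn x fun y => isTransitive y

/-- `y = x ∪ {x}` -/
def isSucc (y x : M) : B := ⨅ z : M, iffB (z ∈ᴮ y) (z ∈ᴮ x ⊔ z ≈ᴮ x)

/-- `x` is a nonzero limit ordinal -/
def isLimit (x : M) : B :=
  isOrdinal x ⊓ (isEmptyB x)ᶜ ⊓ allIn x fun y => exIn x fun z => y ∈ᴮ z

/-! ### Weak compactness -/

/-- `κ` is an infinite regular cardinal: a limit ordinal such that every function from some
`α < κ` to `κ` is bounded below `κ` -/
def isRegular (κ : M) : B :=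
  isLimit κ ⊓
    allIn κ fun α => ⨅ f : M, isFunction f α κ ⇨
      exIn κ fun β => allIn α fun ξ => allIn κ fun η => relB f ξ η ⇨ η ∈ᴮ β

/-- `2 ^ |α| < κ` for all `α < κ`: there is no injection of `κ` into the power set of `α` -/
def isStrongLimit (κ : M) : B :=
  allIn κ fun α => ⨅ p : M, isPowerset p α ⇨ ⨅ f : M, (isInjection f κ p)ᶜ

/-- `κ` is (strongly) inaccessible: regular, above `ω` (there is a limit ordinal below `κ`), and a
strong limit -/
def isInaccessible (κ : M) : B :=
  isRegular κ ⊓ (exIn κ fun α => isLimit α) ⊓ isStrongLimit κ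

/-- `ℓ = {t ∈ T | h t = α}` -/
def isLevel (T h α ℓ : M) : B := ⨅ t : M, iffB (t ∈ᴮ ℓ) (t ∈ᴮ T ⊓ relB h t α)

/-- `(T, L)` is a `κ`-tree with height function `h`: `L` is a strict partial order on `T` in which
the predecessors of each node are linearly ordered, `h t = {h s | s <_L t}` is the height of the
node `t` (so that the predecessors of `t` are well-ordered in type `h t`), the heights which occur
are exactly the ordinals below `κ`, and each level has size less than `κ`. -/
def isKappaTree (κ T L h : M) : B :=
  isRelation L T T ⊓
  (allIn T fun x => (relB L x x)ᶜ) ⊓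
  (allIn T fun x => allIn T fun y => allIn T fun z => relB L x y ⊓ relB L y z ⇨ relB L x z) ⊓
  (allIn T fun x => allIn T fun y => allIn T fun z =>
    relB L x z ⊓ relB L y z ⇨ relB L x y ⊔ x ≈ᴮ y ⊔ relB L y x) ⊓
  isFunction h T κ ⊓
  (allIn T fun t => allIn κ fun α => relB h t α ⇨
    ⨅ β : M, iffB (β ∈ᴮ α) (exIn T fun s => relB L s t ⊓ relB h s β)) ⊓
  (allIn κ fun α => exIn T fun t => relB h t α) ⊓
  (allIn κ fun α => ⨅ ℓ : M, isLevel T h α ℓ ⇨ exIn κ fun μ => ⨆ f : M, isInjection f ℓ μ)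

/-- `b` is a `κ`-branch: a chain of `(T, L)` that meets every level below `κ` -/
def isKappaBranch (κ T L h b : M) : B :=
  subsetB b T ⊓
  (allIn b fun x => allIn b fun y => relB L x y ⊔ x ≈ᴮ y ⊔ relB L y x) ⊓
  (allIn κ fun α => exIn b fun t => relB h t α)

/-- every `κ`-tree has a `κ`-branch -/
def treeProperty (κ : M) : B :=
  ⨅ T : M, ⨅ L : M, ⨅ h : M, isKappaTree κ T L h ⇨ ⨆ b : M, isKappaBranch κ T L h b

/-- `κ` is weakly compact: inaccessible with the tree property -/
def weaklyCompact (κ : M) : B := isInaccessible κ ⊓ treeProperty κ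

/-! ### Forcing notions and strategic closure -/

/-- `(Q, L)` is a forcing notion: a nonempty set with a preorder; `(q, r) ∈ L` means `q ≤ r` -/
def isForcingNotion (Q L : M) : B :=
  (isEmptyB Q)ᶜ ⊓
  (allIn Q fun x => relB L x x) ⊓
  (allIn Q fun x => allIn Q fun y => allIn Q fun z => relB L x y ⊓ relB L y z ⇨ relB L x z)

/-- `α ≤ δ` -/
def isStage (δ α : M) : B := α ∈ᴮ δ ⊔ α ≈ᴮ δ

/-- `T` is the set of stages `α ≤ δ` at which the second player moves: she does not move at `0`,
she moves at limit stages, and the players alternate at successor stages. -/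
def isTurnSet (δ T : M) : B :=
  (allIn T fun α => isStage δ α) ⊓
  (⨅ α : M, isEmptyB α ⇨ (α ∈ᴮ T)ᶜ) ⊓
  (⨅ α : M, isStage δ α ⊓ isLimit α ⇨ α ∈ᴮ T) ⊓
  (⨅ α : M, ⨅ β : M, isStage δ α ⊓ isStage δ β ⊓ isSucc β α ⇨ iffB (β ∈ᴮ T) (α ∈ᴮ T)ᶜ)

/-- `s` is a descending sequence of length `α` in `(Q, L)` -/
def isPlay (Q L α s : M) : B :=
  isFunction s α Q ⊓
    allIn α fun β => allIn β fun γ => allIn Q fun q => allIn Q fun r =>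
      relB s β q ⊓ relB s γ r ⇨ relB L q r

/-- `s' = s ↾ β` -/
def isRestriction (s' s β : M) : B :=
  ⨅ z : M, iffB (z ∈ᴮ s') (z ∈ᴮ s ⊓ exIn β fun ξ => ⨆ q : M, isPair z ξ q)

/-- In the play `s` of length `α`, every move of the second player was made by the strategy `σ`. -/
def follows (T σ α s : M) : B :=
  allIn α fun β => β ∈ᴮ T ⇨
    ⨅ s' : M, isRestriction s' s β ⇨ ⨅ q : M, relB s β q ⇨ relB σ s' q

/-- `σ` is a strategy (a single-valued relation from partial plays to moves) which always provides
the second player with a legal move at each of her stages up to and including `δ` -/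
def isWinningStrategy (Q L δ T σ : M) : B :=
  (⨅ s : M, ⨅ q : M, ⨅ q' : M, relB σ s q ⊓ relB σ s q' ⇨ q ≈ᴮ q') ⊓
  (⨅ α : M, isStage δ α ⊓ α ∈ᴮ T ⇨ ⨅ s : M, isPlay Q L α s ⊓ follows T σ α s ⇨
    exIn Q fun q => relB σ s q ⊓ allIn α fun β => ⨅ r : M, relB s β r ⇨ relB L q r)

/-- `(Q, L)` is `≤ δ`-strategically closed: the second player has a winning strategy in the game in
which the players build a descending `(δ + 1)`-sequence -/
def stratClosed (Q L δ : M) : B :=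
  ⨆ T : M, ⨆ σ : M, isTurnSet δ T ⊓ isWinningStrategy Q L δ T σ

end Formulas

/-! ### The ground model -/

/-- The universe `V`, with true membership and equality. -/
instance : BVal Prop ZFSet.{u} where
  mem x y := x ∈ y
  eq x y := x = y

/-! ### The Boolean-valued universe -/

/-- The class `V^B` of `B`-names: a name is a set of names, each with a Boolean value. -/
inductive BName (B : Type u) : Type (u + 1)
  | mk (ι : Type u) (elt : ι → BName B) (val : ι → B) : BName B

namespace BName

/-- the index type of a name -/
def Idx {B : Type u} : BName B → Type u
  | mk ι _ _ => ι

/-- the names in the domain of a name -/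
def elt {B : Type u} : (x : BName B) → x.Idx → BName B
  | mk _ e _ => e

/-- the Boolean value of equality -/
def beq {B : Type u} [CompleteBooleanAlgebra B] : BName B → BName B → B
  | mk ι x a, mk κ y b =>
    (⨅ i : ι, a i ⇨ ⨆ j : κ, b j ⊓ beq (x i) (y j)) ⊓
      (⨅ j : κ, b j ⇨ ⨆ i : ι, a i ⊓ beq (x i) (y j))

/-- the Boolean value of membership -/
def bmem {B : Type u} [CompleteBooleanAlgebra B] (x : BName B) : BName B → B
  | mk κ y b => ⨆ j : κ, b j ⊓ beq x (y j)

instance {B : Type u} [CompleteBooleanAlgebra B] : BVal B (BName B) where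
  mem := bmem
  eq := beq

/-- the canonical name of a set of the ground model -/
def check {B : Type u} [CompleteBooleanAlgebra B] : PSet.{u} → BName B
  | PSet.mk ι x => mk ι (fun i => check (x i)) fun _ => ⊤

/-- the canonical name of an ordinal -/
noncomputable def checkOrd {B : Type u} [CompleteBooleanAlgebra B] (o : Ordinal.{u}) : BName B :=
  check o.toPSet

end BName

/-! ### The forcing relation -/

/-- The Heyting-regular elements of a frame form a complete Boolean algebra. -/
abbrev regularCompleteBooleanAlgebra (α : Type u) [Order.Frame α] :
    CompleteBooleanAlgebra (Heyting.Regular α) :=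
  { (inferInstance : BooleanAlgebra (Heyting.Regular α)) with
    sSup := fun S => Heyting.Regular.toRegular (sSup (Heyting.Regular.val '' S))
    sInf := fun S => Heyting.Regular.toRegular (sInf (Heyting.Regular.val '' S))
    isLUB_sSup := fun S =>
      ⟨fun a ha => Heyting.Regular.coe_le_coe.1
          ((le_sSup (Set.mem_image_of_mem _ ha)).trans le_compl_compl),
        fun b hb => (Heyting.Regular.gi.gc _ _).2 (sSup_le (by
          rintro _ ⟨a, ha, rfl⟩
          exact hb ha))⟩
    isGLB_sInf := fun S =>
      ⟨fun a ha => (Heyting.Regular.gi.gc _ _).2 (sInf_le (Set.mem_image_of_mem _ ha)),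
        fun b hb => Heyting.Regular.coe_le_coe.1
          ((le_sInf (by
            rintro _ ⟨a, ha, rfl⟩
            exact hb ha)).trans le_compl_compl)⟩ }

/-- The Boolean completion of a forcing notion (`p ≤ q` means that `p` is stronger than `q`): the
regular open subsets, in the topology whose open sets are the downward closed ones. -/
def RO (P : Type u) [Preorder P] : Type u := Heyting.Regular (LowerSet P)

instance (P : Type u) [Preorder P] : CompleteBooleanAlgebra (RO P) :=
  regularCompleteBooleanAlgebra (LowerSet P)

/-- `p ⊩ φ`, for `φ` given by its Boolean value -/
def Forces {P : Type u} [Preorder P] (p : P) (φ : RO P) : Prop :=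
  p ∈ Heyting.Regular.val φ

theorem Forces.mono {P : Type u} [Preorder P] {p q : P} {φ : RO P} (h : q ≤ p)
    (hp : Forces p φ) : Forces q φ :=
  (Heyting.Regular.val φ).lower h hp

theorem Forces.of_le {P : Type u} [Preorder P] {p : P} {φ ψ : RO P} (h : φ ≤ ψ)
    (hp : Forces p φ) : Forces p ψ :=
  h hp

theorem Forces.inf {P : Type u} [Preorder P] {p : P} {φ ψ : RO P}
    (hp : Forces p φ) (hq : Forces p ψ) : Forces p (φ ⊓ ψ) :=
  ⟨hp, hq⟩

/-- A forcing notion is nontrivial when below every condition there are two incompatible ones,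
that is, when no generic filter belongs to the ground model. -/
def NontrivialForcing (P : Type u) [Preorder P] : Prop :=
  ∀ p : P, ∃ q ≤ p, ∃ r ≤ p, ¬ ∃ s : P, s ≤ q ∧ s ≤ r

/-! ### Two-step iterations -/

/-- A `P`-name for a forcing notion. -/
structure PosetName (P : Type u) [Preorder P] where
  carrier : BName (RO P)
  order : BName (RO P)
  isForcing : isForcingNotion carrier order = ⊤

/-- The conditions `(p, q)` of the two-step iteration `P * Q`: `p ∈ P` and `q` is a name in the
domain of the name `Q` such that `p` forces `q ∈ Q`. -/
structure Iteration (P : Type u) [Preorder P] (Q : PosetName P) : Type u where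
  fst : P
  idx : Q.carrier.Idx
  forces_mem : Forces fst (Q.carrier.elt idx ∈ᴮ Q.carrier)

namespace Iteration

variable {P : Type u} [Preorder P] {Q : PosetName P}

/-- the second coordinate, a name -/
def snd (a : Iteration P Q) : BName (RO P) := Q.carrier.elt a.idx

/-- `(p, q) ≤ (p', q')` when `p ≤ p'` and `p` forces `q ≤ q'` -/
instance : Preorder (Iteration P Q) where
  le a b := a.fst ≤ b.fst ∧ Forces a.fst (relB Q.order a.snd b.snd)
  le_refl a := by
    refine ⟨le_rfl, Forces.of_le ?_ a.forces_mem⟩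
    have h : (⊤ : RO P) ≤ allIn Q.carrier fun x => relB Q.order x x := by
      rw [← Q.isForcing]
      exact inf_le_left.trans inf_le_right
    have h' := h.trans (iInf_le _ a.snd)
    rwa [top_le_iff, himp_eq_top_iff] at h'
  le_trans a b c hab hbc := by
    refine ⟨hab.1.trans hbc.1, ?_⟩
    have h : (⊤ : RO P) ≤ allIn Q.carrier fun x => allIn Q.carrier fun y =>
        allIn Q.carrier fun z =>
          relB Q.order x y ⊓ relB Q.order y z ⇨ relB Q.order x z := by
      rw [← Q.isForcing]
      exact inf_le_right
    have h1 := le_himp_iff.1 (h.trans (iInf_le _ a.snd))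
    have h2 := le_himp_iff.1 (h1.trans (iInf_le _ b.snd))
    have h3 := le_himp_iff.1 (h2.trans (iInf_le _ c.snd))
    have h4 := le_himp_iff.1 h3
    refine Forces.of_le h4 ?_
    have hb : Forces a.fst (b.snd ∈ᴮ Q.carrier) := Forces.mono hab.1 b.forces_mem
    have hc : Forces a.fst (c.snd ∈ᴮ Q.carrier) :=
      Forces.mono (hab.1.trans hbc.1) c.forces_mem
    have ht : Forces a.fst (⊤ : RO P) := trivial
    exact (((ht.inf a.forces_mem).inf hb).inf hc).inf (hab.2.inf (Forces.mono hab.1 hbc.2))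

end Iteration

/-- The forcing notion `R` admits a gap at `δ`: it factors, up to isomorphism of Boolean
completions, as `P * Q` where `P` is nontrivial, `|P| < δ`, and it is forced over `P` that `Q` is
`≤ δ`-strategically closed. -/
def AdmitsGapAt (R : Type u) [Preorder R] (δ : Cardinal.{u}) : Prop :=
  ∃ (P : Type u) (_ : Preorder P) (Q : PosetName P),
    NontrivialForcing P ∧ Cardinal.mk P < δ ∧
    (∀ p : P, Forces p (stratClosed Q.carrier Q.order (BName.checkOrd δ.ord))) ∧
    Nonempty (RO R ≃o RO (Iteration P Q))

end GapForcing

namespace GapForcing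

/-! ### Calculus in a complete Boolean algebra -/

section Calculus

variable {B : Type v} [CompleteBooleanAlgebra B] {ι : Sort w} {a φ ψ χ : B}

/-! Inaccessibility descends because ground-model counterexamples survive: an unbounded function
from some `α < κ` stays unbounded, and an injection of `κ` into the ground-model power set of `α` is
an injection into the larger power set of the extension (`isInaccessible_of_forced`).

For the tree property, a `κ`-tree of the ground model is still a `κ`-tree in the extension
(`isKappaTree_ck`), so it acquires a branch `b` there; the task is to find a branch in the ground
model. Replace `R` by `P * Q` and suppose there is none. Then any two conditions below one forcing
that `b` is a branch have extensions forcing incomparable nodes into `b`; otherwise the nodes forced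
in below one of them would be a branch (`exists_branch_of_no_splitting`).

Let the first player in the game on `Q` use this. The conditions `p` of `P` are injected into the
stages below `δ` at which the first player moves. At the stage of `p`, take two incompatible
conditions below `p`, extend the current position over each of them so that incomparable nodes `t`,
`t'` are forced into `b`, and mix the two answers into one name (`exists_splits`). The winning
strategy carries the play through stage `δ` (`exists_descending`). As `δ < κ` and `κ` is regular,
the heights of all these nodes are bounded by some `β < κ`.

Now extend the last move to a condition `y` that decides the node `s` of `b` at level `β`, and look
at the stage of `p`, where `p` is the `P`-coordinate of `y`. Strengthening only that coordinate of
`y` puts either `t` or `t'` into `b` together with `s`. Hence both nodes are comparable with the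
higher node `s`, and so with each other, a contradiction (`exists_branch_of_gap`). -/

theorem le_himp_intro (h : ∀ b ≤ a, b ≤ φ → b ≤ ψ) : a ≤ φ ⇨ ψ :=
  le_himp_iff.2 (h _ inf_le_left inf_le_right)

theorem le_himp_elim (h : a ≤ φ ⇨ ψ) (h' : a ≤ φ) : a ≤ ψ :=
  (le_inf le_rfl h').trans (le_himp_iff.1 h)

theorem le_iSup_elim {f : ι → B} (h : a ≤ ⨆ i, f i) (h' : ∀ i, ∀ b ≤ a, b ≤ f i → b ≤ ψ) :
    a ≤ ψ := by
  have : a ≤ ⨆ i, a ⊓ f i := by rw [← inf_iSup_eq]; exact le_inf le_rfl h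
  exact this.trans (iSup_le fun i => h' i _ inf_le_left inf_le_right)

theorem le_sup_elim (h : a ≤ φ ⊔ χ) (h₁ : ∀ b ≤ a, b ≤ φ → b ≤ ψ) (h₂ : ∀ b ≤ a, b ≤ χ → b ≤ ψ) :
    a ≤ ψ := by
  have : a ≤ a ⊓ φ ⊔ a ⊓ χ := by rw [← inf_sup_left]; exact le_inf le_rfl h
  exact this.trans (sup_le (h₁ _ inf_le_left inf_le_right) (h₂ _ inf_le_left inf_le_right))

theorem le_compl_intro (h : ∀ b ≤ a, b ≤ φ → b ≤ ⊥) : a ≤ φᶜ := by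
  rw [← himp_bot]; exact le_himp_intro h

theorem le_compl_elim (h : a ≤ φᶜ) (h' : a ≤ φ) : a ≤ ψ := by
  rw [← himp_bot] at h; exact (le_himp_elim h h').trans bot_le

/-- Every nonzero element below a supremum meets one of the terms. -/
theorem exists_inf_ne_bot_of_le_iSup {f : ι → B} (ha : a ≠ ⊥) (h : a ≤ ⨆ i, f i) :
    ∃ i, a ⊓ f i ≠ ⊥ := by
  by_contra! hc
  exact ha (le_bot_iff.1 (le_iSup_elim h fun i b hb hi => (le_inf hb hi).trans (hc i).le))

/-- The truth value of a proposition. -/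
def prop (p : Prop) : B := ⨆ _ : p, ⊤

theorem prop_of_true {p : Prop} (h : p) : (prop p : B) = ⊤ := by simp [prop, h]

theorem prop_of_not {p : Prop} (h : ¬ p) : (prop p : B) = ⊥ := by simp [prop, h]

theorem le_prop {p : Prop} (h : p) : a ≤ prop p := by rw [prop_of_true h]; exact le_top

theorem of_le_prop {p : Prop} (ha : a ≠ ⊥) (h : a ≤ prop p) : p := by
  by_contra hp
  rw [prop_of_not hp] at h
  exact ha (le_bot_iff.1 h)

theorem le_prop_elim {p : Prop} (h : a ≤ prop p) (h' : p → a ≤ ψ) : a ≤ ψ := by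
  by_cases hp : p
  · exact h' hp
  · rw [prop_of_not hp] at h; exact h.trans bot_le

theorem prop_inf {p q : Prop} : (prop p ⊓ prop q : B) = prop (p ⊓ q) := by
  by_cases hp : p <;> by_cases hq : q <;> simp [prop, hp, hq]

theorem prop_sup {p q : Prop} : (prop p ⊔ prop q : B) = prop (p ⊔ q) := by
  by_cases hp : p <;> by_cases hq : q <;> simp [prop, hp, hq]

theorem prop_himp {p q : Prop} : (prop p ⇨ prop q : B) = prop (p ⇨ q) := by
  by_cases hp : p <;> by_cases hq : q <;> simp [prop, hp, hq]

theorem prop_compl {p : Prop} : ((prop p)ᶜ : B) = prop pᶜ := by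
  by_cases hp : p <;> simp [prop, hp]

theorem prop_iffB {p q : Prop} : (iffB (prop p) (prop q) : B) = prop (iffB p q) := by
  simp only [iffB, prop_himp, prop_inf]

theorem prop_iInf {p : ι → Prop} : (⨅ i, prop (p i) : B) = prop (⨅ i, p i) := by
  by_cases h : ∀ i, p i
  · rw [prop_of_true (by simpa using h)]
    simp [prop, h]
  · rw [prop_of_not (by simpa using h)]
    push Not at h
    obtain ⟨i, hi⟩ := h
    exact le_bot_iff.1 ((iInf_le _ i).trans (prop_of_not hi).le)

theorem prop_iSup {p : ι → Prop} : (⨆ i, prop (p i) : B) = prop (⨆ i, p i) := by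
  by_cases h : ∃ i, p i
  · rw [prop_of_true (by simpa using h)]
    obtain ⟨i, hi⟩ := h
    exact top_le_iff.1 ((prop_of_true hi).ge.trans (le_iSup (fun i => (prop (p i) : B)) i))
  · rw [prop_of_not (by simpa using h)]
    push Not at h
    simp [prop, h]

theorem iffB_mp (h : a ≤ iffB φ ψ) (h' : a ≤ φ) : a ≤ ψ :=
  le_himp_elim (h.trans inf_le_left) h'

theorem iffB_mpr (h : a ≤ iffB φ ψ) (h' : a ≤ ψ) : a ≤ φ :=
  le_himp_elim (h.trans inf_le_right) h'

theorem le_iffB_intro (h₁ : ∀ b ≤ a, b ≤ φ → b ≤ ψ) (h₂ : ∀ b ≤ a, b ≤ ψ → b ≤ φ) :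
    a ≤ iffB φ ψ :=
  le_inf (le_himp_intro h₁) (le_himp_intro h₂)

end Calculus

section Quantifiers

variable {B : Type v} {M : Type w} [CompleteBooleanAlgebra B] [BVal B M] {a ψ : B} {x : M}
  {φ : M → B}

theorem allIn_elim (h : a ≤ allIn x φ) (z : M) (hz : a ≤ z ∈ᴮ x) : a ≤ φ z :=
  le_himp_elim (h.trans (iInf_le _ z)) hz

theorem le_allIn_intro (h : ∀ z, ∀ b ≤ a, b ≤ z ∈ᴮ x → b ≤ φ z) : a ≤ allIn x φ :=
  le_iInf fun z => le_himp_intro (h z)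

theorem exIn_elim (h : a ≤ exIn x φ) (h' : ∀ z, ∀ b ≤ a, b ≤ z ∈ᴮ x → b ≤ φ z → b ≤ ψ) : a ≤ ψ :=
  le_iSup_elim h fun z b hb hz => h' z b hb (hz.trans inf_le_left) (hz.trans inf_le_right)

theorem le_exIn_intro (z : M) (hz : a ≤ z ∈ᴮ x) (h : a ≤ φ z) : a ≤ exIn x φ :=
  le_iSup_of_le z (le_inf hz h)

end Quantifiers

/-! ### Laws of the Boolean-valued universe -/

namespace BName

variable {B : Type u}

/-- the Boolean value attached to a member of the domain of a name -/
def coeff : (x : BName B) → x.Idx → B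
  | mk _ _ v => v

@[elab_as_elim]
theorem induction {p : BName B → Prop} (h : ∀ x : BName B, (∀ i, p (x.elt i)) → p x)
    (x : BName B) : p x := by
  induction x with
  | mk ι e v ih => exact h _ ih

variable [CompleteBooleanAlgebra B]

theorem mem_def (x y : BName B) : x ∈ᴮ y = ⨆ j : y.Idx, y.coeff j ⊓ x ≈ᴮ y.elt j := by
  cases y; rfl

theorem eq_def (x y : BName B) : x ≈ᴮ y = (⨅ i : x.Idx, x.coeff i ⇨ x.elt i ∈ᴮ y) ⊓
    (⨅ j : y.Idx, y.coeff j ⇨ ⨆ i : x.Idx, x.coeff i ⊓ x.elt i ≈ᴮ y.elt j) := by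
  cases x; cases y; rfl

theorem eq_refl (x : BName B) : x ≈ᴮ x = ⊤ := by
  induction x using induction with
  | h x ih =>
    rw [eq_def, ← top_le_iff]
    refine le_inf (le_iInf fun i => le_himp_intro fun b _ hb => ?_)
      (le_iInf fun i => le_himp_intro fun b _ hb => ?_)
    · rw [mem_def]
      exact le_iSup_of_le i (le_inf hb (by rw [ih]; exact le_top))
    · exact le_iSup_of_le i (le_inf hb (by rw [ih]; exact le_top))

theorem eq_symm (x y : BName B) : x ≈ᴮ y = y ≈ᴮ x := by
  induction x using induction generalizing y with
  | h x ih =>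
    rw [eq_def, eq_def, inf_comm]
    simp only [mem_def, ih]

theorem eq_def' (x y : BName B) : x ≈ᴮ y = (⨅ i : x.Idx, x.coeff i ⇨ x.elt i ∈ᴮ y) ⊓
    (⨅ j : y.Idx, y.coeff j ⇨ y.elt j ∈ᴮ x) := by
  rw [eq_def]
  simp only [mem_def, eq_symm]

theorem elt_mem {a : B} {x : BName B} (i : x.Idx) (h : a ≤ x.coeff i) : a ≤ x.elt i ∈ᴮ x := by
  rw [mem_def]
  exact le_iSup_of_le i (le_inf h (by rw [eq_refl]; exact le_top))

theorem mem_elim {a ψ : B} {x y : BName B} (h : a ≤ x ∈ᴮ y)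
    (h' : ∀ j, ∀ b ≤ a, b ≤ y.coeff j → b ≤ x ≈ᴮ y.elt j → b ≤ ψ) : a ≤ ψ := by
  rw [mem_def] at h
  exact le_iSup_elim h fun j b hb hj => h' j b hb (hj.trans inf_le_left) (hj.trans inf_le_right)

theorem eq_elim {a : B} {x y : BName B} (h : a ≤ x ≈ᴮ y) (i : x.Idx) (hi : a ≤ x.coeff i) :
    a ≤ x.elt i ∈ᴮ y := by
  rw [eq_def] at h
  exact le_himp_elim ((h.trans inf_le_left).trans (iInf_le _ i)) hi

theorem symm {a : B} {x y : BName B} (h : a ≤ x ≈ᴮ y) : a ≤ y ≈ᴮ x := by rwa [eq_symm]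

theorem refl {a : B} (x : BName B) : a ≤ x ≈ᴮ x := by rw [eq_refl]; exact le_top

/-- Induction on the first name suffices: both halves chase an element through `y`, and symmetry
puts an element of `x` first in the second half. -/
theorem trans {a : B} {x y z : BName B} (h : a ≤ x ≈ᴮ y) (h' : a ≤ y ≈ᴮ z) : a ≤ x ≈ᴮ z := by
  induction x using induction generalizing y z a with
  | h x ih =>
    rw [eq_def']
    refine le_inf (le_iInf fun i => le_himp_intro fun b hb hi => ?_)
      (le_iInf fun k => le_himp_intro fun b hb hk => ?_)
    · refine mem_elim (eq_elim (hb.trans h) i hi) fun j c hc hj e => ?_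
      refine mem_elim (eq_elim (hc.trans (hb.trans h')) j hj) fun k d hd hk e' => ?_
      rw [mem_def]
      exact le_iSup_of_le k (le_inf hk (ih i (hd.trans e) e'))
    · refine mem_elim (eq_elim (symm (hb.trans h')) k hk) fun j c hc hj e => ?_
      refine mem_elim (eq_elim (symm (hc.trans (hb.trans h))) j hj) fun i d hd hi e' => ?_
      rw [mem_def]
      exact le_iSup_of_le i (le_inf hi (symm (ih i (symm e') (symm (hd.trans e)))))

theorem mem_congr_left {a : B} {x x' y : BName B} (h : a ≤ x ≈ᴮ x') (hx : a ≤ x ∈ᴮ y) :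
    a ≤ x' ∈ᴮ y :=
  mem_elim hx fun j b hb hj e => by
    rw [mem_def]
    exact le_iSup_of_le j (le_inf hj (trans (symm (hb.trans h)) e))

theorem mem_congr_right {a : B} {x y y' : BName B} (h : a ≤ y ≈ᴮ y') (hx : a ≤ x ∈ᴮ y) :
    a ≤ x ∈ᴮ y' :=
  mem_elim hx fun j _ hb hj e => mem_congr_left (symm e) (eq_elim (hb.trans h) j hj)

/-- Extensionality. -/
theorem eq_of_mem_iff {a : B} {x y : BName B} (h : ∀ z, ∀ b ≤ a, b ≤ z ∈ᴮ x → b ≤ z ∈ᴮ y)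
    (h' : ∀ z, ∀ b ≤ a, b ≤ z ∈ᴮ y → b ≤ z ∈ᴮ x) : a ≤ x ≈ᴮ y := by
  rw [eq_def']
  exact le_inf (le_iInf fun i => le_himp_intro fun b hb hi => h _ b hb (elt_mem i hi))
    (le_iInf fun i => le_himp_intro fun b hb hi => h' _ b hb (elt_mem i hi))

/-! ### Extensional formulas -/

/-- The formula `φ` respects equality. -/
class Ext (φ : BName B → B) : Prop where
  congr : ∀ {a : B} {x y : BName B}, a ≤ x ≈ᴮ y → a ≤ φ x → a ≤ φ y

/-- The term `f` respects equality. -/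
class ExtTerm (f : BName B → BName B) : Prop where
  congr : ∀ {a : B} {x y : BName B}, a ≤ x ≈ᴮ y → a ≤ f x ≈ᴮ f y

section Ext

variable {f g k l m : BName B → BName B} {φ ψ : BName B → B}

/-- These instances follow the construction of formulas, so instance search supplies substitution of
equals in every formula used below. -/
instance : ExtTerm (fun x : BName B => x) := ⟨id⟩

instance (c : BName B) : ExtTerm (fun _ : BName B => c) := ⟨fun _ => refl c⟩

instance (c : B) : Ext (fun _ : BName B => c) := ⟨fun _ h => h⟩

instance [ExtTerm f] [ExtTerm g] : Ext (fun x => f x ∈ᴮ g x) :=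
  ⟨fun h hx => mem_congr_left (ExtTerm.congr h) (mem_congr_right (ExtTerm.congr h) hx)⟩

instance [ExtTerm f] [ExtTerm g] : Ext (fun x => f x ≈ᴮ g x) :=
  ⟨fun h hx => trans (symm (ExtTerm.congr h)) (trans hx (ExtTerm.congr h))⟩

/-- The eta-reduced form, which arises when such a predicate is the body of a bounded quantifier. -/
instance (c : BName B) : Ext (BVal.mem c) := ⟨mem_congr_right⟩

instance (c : BName B) : Ext (BVal.eq c) := ⟨fun h hx => trans hx h⟩

instance [Ext φ] [Ext ψ] : Ext (fun x => φ x ⊓ ψ x) :=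
  ⟨fun h hx => le_inf (Ext.congr h (hx.trans inf_le_left)) (Ext.congr h (hx.trans inf_le_right))⟩

instance [Ext φ] [Ext ψ] : Ext (fun x => φ x ⊔ ψ x) :=
  ⟨fun h hx => le_sup_elim hx (fun _ hb hc => (Ext.congr (hb.trans h) hc).trans le_sup_left)
    fun _ hb hc => (Ext.congr (hb.trans h) hc).trans le_sup_right⟩

instance [Ext φ] [Ext ψ] : Ext (fun x => φ x ⇨ ψ x) :=
  ⟨fun h hx => le_himp_intro fun _ hb hc => Ext.congr (hb.trans h)
    (le_himp_elim (hb.trans hx) (Ext.congr (symm (hb.trans h)) hc))⟩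

instance [Ext φ] : Ext (fun x => (φ x)ᶜ) :=
  ⟨fun h hx => le_compl_intro fun _ hb hc =>
    le_compl_elim (hb.trans hx) (Ext.congr (symm (hb.trans h)) hc)⟩

instance {ι : Sort w} {Φ : BName B → ι → B} [∀ i, Ext fun x => Φ x i] :
    Ext (fun x => ⨅ i, Φ x i) :=
  ⟨fun h hx => le_iInf fun i => Ext.congr (φ := fun x => Φ x i) h (hx.trans (iInf_le _ i))⟩

instance {ι : Sort w} {Φ : BName B → ι → B} [∀ i, Ext fun x => Φ x i] :
    Ext (fun x => ⨆ i, Φ x i) :=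
  ⟨fun h hx => le_iSup_elim hx fun i _ hb hc =>
    le_iSup_of_le i (Ext.congr (φ := fun x => Φ x i) (hb.trans h) hc)⟩

instance [Ext φ] [Ext ψ] : Ext (fun x => iffB (φ x) (ψ x)) := by unfold iffB; infer_instance

instance {Φ : BName B → BName B → B} [ExtTerm f] [∀ z, Ext fun x => Φ x z] :
    Ext (fun x => allIn (f x) (Φ x)) := by unfold allIn; infer_instance

instance {Φ : BName B → BName B → B} [ExtTerm f] [∀ z, Ext fun x => Φ x z] :
    Ext (fun x => exIn (f x) (Φ x)) := by unfold exIn; infer_instance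

instance [ExtTerm f] [ExtTerm g] : Ext (fun x => subsetB (f x) (g x)) := by
  unfold subsetB; infer_instance

instance (c : BName B) : Ext (subsetB c) := by
  change Ext fun x => subsetB c x; unfold subsetB; infer_instance

instance [ExtTerm f] : Ext (fun x => isEmptyB (f x)) := by unfold isEmptyB; infer_instance

instance : Ext (isEmptyB (M := BName B)) := by
  change Ext fun x => isEmptyB x; unfold isEmptyB; infer_instance

instance [ExtTerm f] [ExtTerm g] [ExtTerm k] : Ext (fun x => isUPair (f x) (g x) (k x)) := by
  unfold isUPair; infer_instance

instance (c d : BName B) : Ext (isUPair c d) := by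
  change Ext fun x => isUPair c d x; unfold isUPair; infer_instance

instance [ExtTerm f] [ExtTerm g] [ExtTerm k] : Ext (fun x => isPair (f x) (g x) (k x)) := by
  unfold isPair; infer_instance

instance (c d : BName B) : Ext (isPair c d) := by
  change Ext fun x => isPair c d x; unfold isPair; infer_instance

instance [ExtTerm f] [ExtTerm g] [ExtTerm k] : Ext (fun x => relB (f x) (g x) (k x)) := by
  unfold relB; infer_instance

instance (c d : BName B) : Ext (relB c d) := by
  change Ext fun x => relB c d x; unfold relB; infer_instance

instance [ExtTerm f] [ExtTerm g] [ExtTerm k] : Ext (fun x => isRelation (f x) (g x) (k x)) := by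
  unfold isRelation; infer_instance

instance [ExtTerm f] [ExtTerm g] [ExtTerm k] : Ext (fun x => isFunction (f x) (g x) (k x)) := by
  unfold isFunction; infer_instance

instance [ExtTerm f] [ExtTerm g] [ExtTerm k] : Ext (fun x => isInjection (f x) (g x) (k x)) := by
  unfold isInjection; infer_instance

instance [ExtTerm f] [ExtTerm g] : Ext (fun x => isPowerset (f x) (g x)) := by
  unfold isPowerset; infer_instance

instance [ExtTerm f] : Ext (fun x => isTransitive (f x)) := by unfold isTransitive; infer_instance

instance : Ext (isTransitive (M := BName B)) := by
  change Ext fun x => isTransitive x; unfold isTransitive; infer_instance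

instance [ExtTerm f] : Ext (fun x => isOrdinal (f x)) := by unfold isOrdinal; infer_instance

instance : Ext (isOrdinal (M := BName B)) := by
  change Ext fun x => isOrdinal x; unfold isOrdinal; infer_instance

instance [ExtTerm f] [ExtTerm g] : Ext (fun x => isSucc (f x) (g x)) := by
  unfold isSucc; infer_instance

instance [ExtTerm f] : Ext (fun x => isLimit (f x)) := by unfold isLimit; infer_instance

instance : Ext (isLimit (M := BName B)) := by
  change Ext fun x => isLimit x; unfold isLimit; infer_instance

instance [ExtTerm f] : Ext (fun x => isRegular (f x)) := by unfold isRegular; infer_instance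

instance [ExtTerm f] : Ext (fun x => isStrongLimit (f x)) := by
  unfold isStrongLimit; infer_instance

instance [ExtTerm f] : Ext (fun x => isInaccessible (f x)) := by
  unfold isInaccessible; infer_instance

instance [ExtTerm f] [ExtTerm g] [ExtTerm k] [ExtTerm l] :
    Ext (fun x => isLevel (f x) (g x) (k x) (l x)) := by
  unfold isLevel; infer_instance

set_option synthInstance.maxSize 2000 in
set_option synthInstance.maxHeartbeats 200000 in
instance [ExtTerm f] [ExtTerm g] [ExtTerm k] [ExtTerm l] :
    Ext (fun x => isKappaTree (f x) (g x) (k x) (l x)) := by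
  unfold isKappaTree; infer_instance

instance [ExtTerm f] [ExtTerm g] [ExtTerm k] [ExtTerm l] [ExtTerm m] :
    Ext (fun x => isKappaBranch (f x) (g x) (k x) (l x) (m x)) := by
  unfold isKappaBranch; infer_instance

instance [ExtTerm f] : Ext (fun x => treeProperty (f x)) := by
  unfold treeProperty; infer_instance

instance ext_weaklyCompact [ExtTerm f] : Ext (fun x => weaklyCompact (f x)) := by
  unfold weaklyCompact; infer_instance

instance [ExtTerm f] [ExtTerm g] : Ext (fun x => isStage (f x) (g x)) := by
  unfold isStage; infer_instance

instance [ExtTerm f] [ExtTerm g] : Ext (fun x => isTurnSet (f x) (g x)) := by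
  unfold isTurnSet; infer_instance

instance [ExtTerm f] [ExtTerm g] [ExtTerm k] [ExtTerm l] :
    Ext (fun x => isPlay (f x) (g x) (k x) (l x)) := by
  unfold isPlay; infer_instance

instance [ExtTerm f] [ExtTerm g] [ExtTerm k] :
    Ext (fun x => isRestriction (f x) (g x) (k x)) := by
  unfold isRestriction; infer_instance

instance (c d : BName B) : Ext (isRestriction c d) := by
  change Ext fun x => isRestriction c d x; unfold isRestriction; infer_instance

instance [ExtTerm f] [ExtTerm g] [ExtTerm k] [ExtTerm l] :
    Ext (fun x => follows (f x) (g x) (k x) (l x)) := by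
  unfold follows; infer_instance

instance [ExtTerm f] [ExtTerm g] [ExtTerm k] [ExtTerm l] [ExtTerm m] :
    Ext (fun x => isWinningStrategy (f x) (g x) (k x) (l x) (m x)) := by
  unfold isWinningStrategy; infer_instance

end Ext

end BName

/-! ### Pairs of the ground model -/

theorem mem_iff_zf {x y : ZFSet.{u}} : x ∈ᴮ y ↔ x ∈ y := Iff.rfl

theorem eq_iff_zf {x y : ZFSet.{u}} : x ≈ᴮ y ↔ x = y := Iff.rfl

theorem iffB_iff {p q : Prop} : iffB p q ↔ (p ↔ q) := by
  simp only [iffB, himp_iff_imp, inf_Prop_eq]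
  tauto

theorem allIn_iff {a : ZFSet.{u}} {φ : ZFSet.{u} → Prop} : allIn a φ ↔ ∀ x ∈ a, φ x := by
  simp [allIn, mem_iff_zf]

theorem exIn_iff {a : ZFSet.{u}} {φ : ZFSet.{u} → Prop} : exIn a φ ↔ ∃ x ∈ a, φ x := by
  simp [exIn, mem_iff_zf]

theorem isUPair_iff {x y z : ZFSet.{u}} : isUPair z x y ↔ z = {x, y} := by
  simp only [isUPair, iInf_Prop_eq, iffB_iff, mem_iff_zf, eq_iff_zf, sup_Prop_eq]
  constructor
  · intro h
    ext t
    simpa using h t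
  · rintro rfl t
    simp

theorem isPair_iff {x y z : ZFSet.{u}} : isPair z x y ↔ z = ZFSet.pair x y := by
  simp [isPair, isUPair_iff, ZFSet.pair]

theorem relB_iff {R x y : ZFSet.{u}} : relB R x y ↔ ZFSet.pair x y ∈ R := by
  simp [relB, exIn_iff, isPair_iff]

namespace BName

variable {B : Type u} [CompleteBooleanAlgebra B] {a ψ : B}

/-! ### Pairs in the Boolean-valued universe -/

/-- the unordered pair of two names -/
def upair (x y : BName B) : BName B :=
  mk (ULift Bool) (fun i => bif i.down then x else y) fun _ => ⊤

theorem mem_upair (x y z : BName B) : z ∈ᴮ upair x y = z ≈ᴮ x ⊔ z ≈ᴮ y := by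
  rw [mem_def]
  apply le_antisymm
  · refine iSup_le fun i => inf_le_right.trans ?_
    rcases i with ⟨_ | _⟩
    · exact le_sup_right
    · exact le_sup_left
  · exact sup_le (le_iSup_of_le (ι := ULift Bool) ⟨true⟩ (le_inf le_top le_rfl))
      (le_iSup_of_le (ι := ULift Bool) ⟨false⟩ (le_inf le_top le_rfl))

theorem left_mem_upair (x y : BName B) : a ≤ x ∈ᴮ upair x y := by
  rw [mem_upair, eq_refl, top_sup_eq]; exact le_top

theorem right_mem_upair (x y : BName B) : a ≤ y ∈ᴮ upair x y := by
  rw [mem_upair, eq_refl, sup_top_eq]; exact le_top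

/-- the ordered pair of two names -/
def pair (x y : BName B) : BName B := upair (upair x x) (upair x y)

instance {f g : BName B → BName B} [ExtTerm f] [ExtTerm g] :
    ExtTerm (fun x => upair (f x) (g x)) := by
  refine ⟨fun {a x y} h => eq_of_mem_iff (fun z b hb hz => ?_) fun z b hb hz => ?_⟩
  · rw [mem_upair] at hz ⊢
    exact Ext.congr (φ := fun x => z ≈ᴮ f x ⊔ z ≈ᴮ g x) (hb.trans h) hz
  · rw [mem_upair] at hz ⊢
    exact Ext.congr (φ := fun x => z ≈ᴮ f x ⊔ z ≈ᴮ g x) (symm (hb.trans h)) hz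

instance (c : BName B) : ExtTerm (upair c) := by
  refine ⟨fun {a x y} h => eq_of_mem_iff (fun z b hb hz => ?_) fun z b hb hz => ?_⟩
  · rw [mem_upair] at hz ⊢
    exact Ext.congr (φ := fun x => z ≈ᴮ c ⊔ z ≈ᴮ x) (hb.trans h) hz
  · rw [mem_upair] at hz ⊢
    exact Ext.congr (φ := fun x => z ≈ᴮ c ⊔ z ≈ᴮ x) (symm (hb.trans h)) hz

instance {f g : BName B → BName B} [ExtTerm f] [ExtTerm g] :
    ExtTerm (fun x => pair (f x) (g x)) := by unfold pair; infer_instance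

theorem isUPair_eq (x y z : BName B) : isUPair z x y = z ≈ᴮ upair x y := by
  apply le_antisymm
  · refine eq_of_mem_iff (fun t b hb ht => ?_) fun t b hb ht => ?_
    · rw [mem_upair]
      exact iffB_mp (hb.trans (iInf_le _ t)) ht
    · rw [mem_upair] at ht
      exact iffB_mpr (hb.trans (iInf_le _ t)) ht
  · refine le_iInf fun t => ?_
    rw [← mem_upair]
    exact le_iffB_intro (fun b hb ht => mem_congr_right hb ht)
      fun b hb ht => mem_congr_right (symm hb) ht

theorem isPair_eq (x y z : BName B) : isPair z x y = z ≈ᴮ pair x y := by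
  simp only [isPair, isUPair_eq]
  apply le_antisymm
  · refine iSup_le fun s => iSup_le fun t => ?_
    have h₁ : s ≈ᴮ upair x x ⊓ t ≈ᴮ upair x y ⊓ z ≈ᴮ upair s t ≤ s ≈ᴮ upair x x :=
      inf_le_left.trans inf_le_left
    have h₂ : s ≈ᴮ upair x x ⊓ t ≈ᴮ upair x y ⊓ z ≈ᴮ upair s t ≤ t ≈ᴮ upair x y :=
      inf_le_left.trans inf_le_right
    refine trans inf_le_right (trans (ExtTerm.congr (f := fun s => upair s t) h₁) ?_)
    exact ExtTerm.congr (f := fun t => upair (upair x x) t) h₂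
  · refine le_iSup_of_le (upair x x) (le_iSup_of_le (upair x y) ?_)
    exact le_inf (le_inf (refl _) (refl _)) le_rfl

theorem relB_eq (R x y : BName B) : relB R x y = pair x y ∈ᴮ R := by
  apply le_antisymm
  · refine exIn_elim le_rfl fun z b _ hz h => ?_
    rw [isPair_eq] at h
    exact mem_congr_left h hz
  · exact le_exIn_intro (pair x y) le_rfl (by rw [isPair_eq]; exact refl _)

theorem upair_self_elim {x y y' : BName B} (h : a ≤ upair x x ≈ᴮ upair y y') : a ≤ y ≈ᴮ x := by
  have := mem_congr_right (symm h) (left_mem_upair y y')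
  rwa [mem_upair, sup_idem] at this

theorem pair_eq_left {x y x' y' : BName B} (h : a ≤ pair x y ≈ᴮ pair x' y') : a ≤ x ≈ᴮ x' := by
  have h₁ := mem_congr_right h (left_mem_upair (upair x x) (upair x y))
  rw [pair, mem_upair] at h₁
  exact le_sup_elim h₁ (fun b _ hb => symm (upair_self_elim hb))
    fun b _ hb => symm (upair_self_elim hb)

/-- Since `{x, y}` is one of `{x, x}` and `{x, y'}`, its member `y` is `x` or `y'`. The degenerate
case `y = x` is removed in `pair_eq_right` by exchanging `y` and `y'`. -/
theorem right_eq_or_of_pair_eq {x y y' : BName B} (h : a ≤ pair x y ≈ᴮ pair x y') :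
    a ≤ y ≈ᴮ y' ⊔ y ≈ᴮ x := by
  have h₁ := mem_congr_right h (right_mem_upair (upair x x) (upair x y))
  rw [pair, mem_upair] at h₁
  refine le_sup_elim h₁ (fun b _ hb => ?_) fun b _ hb => ?_
  · have := mem_congr_right hb (right_mem_upair x y)
    rw [mem_upair, sup_idem] at this
    exact this.trans le_sup_right
  · have := mem_congr_right hb (right_mem_upair x y)
    rwa [mem_upair, sup_comm] at this

theorem pair_eq_right {x y x' y' : BName B} (h : a ≤ pair x y ≈ᴮ pair x' y') : a ≤ y ≈ᴮ y' := by
  have hx := pair_eq_left h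
  have h' : a ≤ pair x y ≈ᴮ pair x y' :=
    trans h (ExtTerm.congr (f := fun x => pair x y') (symm hx))
  refine le_sup_elim (right_eq_or_of_pair_eq h') (fun b _ hb => hb) fun b hb hy => ?_
  exact le_sup_elim (right_eq_or_of_pair_eq (symm (hb.trans h'))) (fun c _ hc => symm hc)
    fun c hc hcx => trans (hc.trans hy) (symm hcx)

/-! ### Canonical names -/

theorem check_eq_check (x y : PSet.{u}) : (check x : BName B) ≈ᴮ check y = prop (x.Equiv y) := by
  induction x generalizing y with
  | mk ι x ih =>
    cases y with
    | mk κ y =>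
      have : (check (PSet.mk ι x) : BName B) ≈ᴮ check (PSet.mk κ y) =
          (⨅ i : ι, ⊤ ⇨ ⨆ j : κ, ⊤ ⊓ (check (x i) : BName B) ≈ᴮ check (y j)) ⊓
          (⨅ j : κ, ⊤ ⇨ ⨆ i : ι, ⊤ ⊓ (check (x i) : BName B) ≈ᴮ check (y j)) := rfl
      rw [this]
      simp only [ih, top_himp, top_inf_eq, prop_iSup, prop_iInf, prop_inf]
      congr 1
      simp [PSet.Equiv]

theorem mem_check (z : BName B) (y : PSet.{u}) :
    z ∈ᴮ check y = ⨆ i : y.Type, z ≈ᴮ check (y.Func i) := by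
  cases y with
  | mk κ y =>
    have : z ∈ᴮ (check (PSet.mk κ y) : BName B) = ⨆ i : κ, ⊤ ⊓ z ≈ᴮ check (y i) := rfl
    simp only [this, top_inf_eq]
    rfl

/-- the canonical name of a set of the ground model -/
noncomputable def ck (x : ZFSet.{u}) : BName B := check x.out

theorem eq_ck (x y : ZFSet.{u}) : (ck x : BName B) ≈ᴮ ck y = prop (x ≈ᴮ y) := by
  rw [ck, ck, check_eq_check, ← ZFSet.eq, ZFSet.mk_out, ZFSet.mk_out]
  rfl

theorem check_eq_ck (x : PSet.{u}) : a ≤ (check x : BName B) ≈ᴮ ck (ZFSet.mk x) := by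
  rw [ck, check_eq_check]
  exact le_prop (ZFSet.eq.1 (ZFSet.mk_out _).symm)

theorem checkOrd_eq_ck (o : Ordinal.{u}) : a ≤ (checkOrd o : BName B) ≈ᴮ ck o.toZFSet := check_eq_ck _

/-- The source of all absoluteness below: a member of a canonical name is locally equal to the
canonical name of a ground-model set. -/
theorem mem_ck_elim {z : BName B} {y : ZFSet.{u}} (h : a ≤ z ∈ᴮ ck y)
    (h' : ∀ x ∈ y, ∀ b ≤ a, b ≤ z ≈ᴮ ck x → b ≤ ψ) : a ≤ ψ := by
  rw [ck, mem_check] at h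
  refine le_iSup_elim h fun i b hb hi => h' (ZFSet.mk (y.out.Func i)) ?_ b hb
    (trans hi (check_eq_ck _))
  have : ZFSet.mk (y.out.Func i) ∈ ZFSet.mk y.out := ZFSet.mk_mem_iff.2 (PSet.func_mem _ _)
  rwa [ZFSet.mk_out] at this

theorem mem_ck (x y : ZFSet.{u}) : (ck x : BName B) ∈ᴮ ck y = prop (x ∈ᴮ y) := by
  apply le_antisymm
  · refine mem_ck_elim le_rfl fun z hz b _ hb => ?_
    rw [eq_ck] at hb
    exact le_prop_elim hb fun e => le_prop (by rw [eq_iff_zf] at e; subst e; exact hz)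
  · refine le_prop_elim le_rfl fun h => ?_
    rw [mem_iff_zf, ← ZFSet.mk_out x, ← ZFSet.mk_out y, ZFSet.mk_mem_iff] at h
    obtain ⟨i, hi⟩ : ∃ i : y.out.Type, x.out.Equiv (y.out.Func i) := by
      rwa [PSet.mem_def] at h
    rw [ck, ck, mem_check]
    refine le_iSup_of_le i ?_
    rw [check_eq_check]
    exact le_prop hi

theorem ck_mem_ck {x y : ZFSet.{u}} (h : x ∈ y) : a ≤ (ck x : BName B) ∈ᴮ ck y := by
  rw [mem_ck]; exact le_prop h

/-! ### Absoluteness of bounded formulas for canonical names. -/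

section Absoluteness

variable {φ : BName B → B} {χ : ZFSet.{u} → Prop}

/-- Members of `ck y` are locally canonical names, so an extensional `φ` need only be tested on
those. -/
theorem allIn_ck [Ext φ] (h : ∀ x, φ (ck x) = prop (χ x)) (y : ZFSet.{u}) :
    allIn (ck y) φ = prop (allIn y χ) := by
  apply le_antisymm
  · rw [allIn, allIn, ← prop_iInf]
    refine le_iInf fun x => (iInf_le _ (ck x)).trans ?_
    rw [mem_ck, h, prop_himp]
  · refine le_prop_elim le_rfl fun hp => le_allIn_intro fun z b _ hz => mem_ck_elim hz
      fun x hx c _ e => Ext.congr (symm e) ?_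
    rw [h]
    exact le_prop (allIn_iff.1 hp x hx)

theorem exIn_ck_elim [Ext φ] {y : ZFSet.{u}} (h : a ≤ exIn (ck y) φ)
    (h' : ∀ x ∈ y, ∀ b ≤ a, b ≤ φ (ck x) → b ≤ ψ) : a ≤ ψ :=
  exIn_elim h fun _ _ hb hz hφ => mem_ck_elim hz fun x hx _ hc e =>
    h' x hx _ (hc.trans hb) (Ext.congr e (hc.trans hφ))

theorem exIn_ck [Ext φ] (h : ∀ x, φ (ck x) = prop (χ x)) (y : ZFSet.{u}) :
    exIn (ck y) φ = prop (exIn y χ) := by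
  apply le_antisymm
  · refine exIn_ck_elim le_rfl fun x hx c _ e => ?_
    rw [h] at e
    exact le_prop_elim e fun hc => le_prop (exIn_iff.2 ⟨x, hx, hc⟩)
  · rw [exIn, exIn, ← prop_iSup]
    refine iSup_le fun x => le_trans ?_ (le_iSup _ (ck x))
    rw [mem_ck, h, prop_inf]

theorem le_allIn_ck [Ext φ] {y : ZFSet.{u}} (h : ∀ x ∈ y, a ≤ φ (ck x)) : a ≤ allIn (ck y) φ :=
  le_allIn_intro fun _ _ hb hz => mem_ck_elim hz fun x hx _ hc e =>
    Ext.congr (symm e) (hc.trans (hb.trans (h x hx)))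

theorem allIn_ck_elim {y x : ZFSet.{u}} (h : a ≤ allIn (ck y) φ) (hx : x ∈ y) : a ≤ φ (ck x) :=
  allIn_elim h _ (ck_mem_ck hx)

/-- the truth value of `z` belongs to the ground model -/
noncomputable def std (z : BName B) : B := ⨆ x : ZFSet.{u}, z ≈ᴮ ck x

theorem le_std {z : BName B} {x : ZFSet.{u}} (h : a ≤ z ≈ᴮ ck x) : a ≤ std z := le_iSup_of_le x h

theorem std_of_mem_ck {z : BName B} {y : ZFSet.{u}} (h : a ≤ z ∈ᴮ ck y) : a ≤ std z :=
  mem_ck_elim h fun _ _ _ _ e => le_std e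

theorem std_of_mem {z y : BName B} (h : a ≤ z ∈ᴮ y) (hy : a ≤ std y) : a ≤ std z :=
  le_iSup_elim hy fun _ _ hb e => std_of_mem_ck (mem_congr_right e (hb.trans h))

theorem std_right_of_pair_mem {x y : BName B} {R : ZFSet.{u}} (h : a ≤ pair x y ∈ᴮ ck R) :
    a ≤ std y :=
  std_of_mem (right_mem_upair x y) (std_of_mem (right_mem_upair _ _) (std_of_mem_ck h))

/-- Definitions by extensionality quantify over all names. If `φ` holds only of ground-model sets,
then outside the ground model both sides of the equivalence are false, and the quantifier reduces to
canonical names. -/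
theorem iInf_iffB_ck [Ext φ] (hs : ∀ z, φ z ≤ std z) (h : ∀ x, φ (ck x) = prop (χ x))
    (y : ZFSet.{u}) : ⨅ z, iffB (z ∈ᴮ ck y) (φ z) = prop (⨅ x, iffB (x ∈ᴮ y) (χ x)) := by
  apply le_antisymm
  · rw [← prop_iInf]
    refine le_iInf fun x => (iInf_le _ (ck x)).trans ?_
    rw [mem_ck, h, prop_iffB]
  · refine le_prop_elim le_rfl fun hp => le_iInf fun z => ?_
    have key : ∀ c : B, c ≤ std z → c ≤ iffB (z ∈ᴮ ck y) (φ z) := fun c hc =>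
      le_iSup_elim hc fun x d _ e =>
        Ext.congr (φ := fun z => iffB (z ∈ᴮ ck y) (φ z)) (symm e) (by
          rw [mem_ck, h, prop_iffB]
          rw [iInf_Prop_eq] at hp
          exact le_prop (hp x))
    exact le_iffB_intro (fun b _ hb => iffB_mp (key b (std_of_mem_ck hb)) hb)
      fun b _ hb => iffB_mpr (key b (hb.trans (hs z))) hb

theorem isUPair_ck (z x y : ZFSet.{u}) :
    isUPair (ck z : BName B) (ck x) (ck y) = prop (isUPair z x y) := by
  refine iInf_iffB_ck (fun t => sup_le (le_std le_rfl) (le_std le_rfl)) (fun t => ?_) z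
  rw [eq_ck, eq_ck, prop_sup]

theorem ck_pair (x y : ZFSet.{u}) : a ≤ (ck (ZFSet.pair x y) : BName B) ≈ᴮ pair (ck x) (ck y) := by
  have h : ∀ x y : ZFSet.{u}, a ≤ (ck {x, y} : BName B) ≈ᴮ upair (ck x) (ck y) := fun x y => by
    rw [← isUPair_eq, isUPair_ck]
    exact le_prop (isUPair_iff.2 rfl)
  have hx := h x x
  rw [ZFSet.pair_eq_singleton] at hx
  refine trans (h {x} {x, y}) (trans (ExtTerm.congr (f := fun s => upair s (ck {x, y})) hx) ?_)
  exact ExtTerm.congr (f := fun s => upair (upair (ck x) (ck x)) s) (h x y)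

theorem isPair_ck (z x y : ZFSet.{u}) :
    isPair (ck z : BName B) (ck x) (ck y) = prop (isPair z x y) := by
  have h : (ck z : BName B) ≈ᴮ pair (ck x) (ck y) = ck z ≈ᴮ ck (ZFSet.pair x y) :=
    le_antisymm (trans le_rfl (symm (ck_pair x y))) (trans le_rfl (ck_pair x y))
  rw [isPair_eq, h, eq_ck]
  congr 1
  exact propext isPair_iff.symm

theorem relB_ck (R x y : ZFSet.{u}) :
    relB (ck R : BName B) (ck x) (ck y) = prop (relB R x y) :=
  exIn_ck (fun z => isPair_ck z x y) R

theorem isRelation_ck (R x y : ZFSet.{u}) :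
    isRelation (ck R : BName B) (ck x) (ck y) = prop (isRelation R x y) :=
  allIn_ck (fun _ => exIn_ck (fun _ => exIn_ck (fun _ => isPair_ck _ _ _) _) _) _

theorem isFunction_ck (f x y : ZFSet.{u}) :
    isFunction (ck f : BName B) (ck x) (ck y) = prop (isFunction f x y) := by
  rw [isFunction, isFunction, ← prop_inf, isRelation_ck]
  congr 1
  refine allIn_ck (fun s => exIn_ck (fun t => ?_) _) _
  rw [← prop_inf, relB_ck]
  congr 1
  refine allIn_ck (fun t' => ?_) _
  rw [relB_ck, eq_ck, prop_himp]

theorem isInjection_ck (f x y : ZFSet.{u}) :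
    isInjection (ck f : BName B) (ck x) (ck y) = prop (isInjection f x y) := by
  rw [isInjection, isInjection, ← prop_inf, isFunction_ck]
  congr 1
  refine allIn_ck (fun s => allIn_ck (fun s' => allIn_ck (fun t => ?_) _) _) _
  rw [relB_ck, relB_ck, eq_ck, prop_inf, prop_himp]

theorem subsetB_ck (x y : ZFSet.{u}) : subsetB (ck x : BName B) (ck y) = prop (subsetB x y) :=
  allIn_ck (fun z => mem_ck z y) x

theorem isEmptyB_ck (x : ZFSet.{u}) : isEmptyB (ck x : BName B) = prop (isEmptyB x) := by
  -- Emptiness becomes a bounded quantifier with a false body, so that `allIn_ck` applies.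
  have h : isEmptyB (ck x : BName B) = allIn (ck x : BName B) fun _ => (prop False : B) := by
    rw [isEmptyB, allIn, prop_of_not not_false]; simp
  rw [h, allIn_ck (φ := fun _ => (prop False : B)) (χ := fun _ => False) (fun _ => rfl) x]
  congr 1

theorem isTransitive_ck (x : ZFSet.{u}) :
    isTransitive (ck x : BName B) = prop (isTransitive x) :=
  allIn_ck (fun z => subsetB_ck z x) x

theorem isOrdinal_ck (x : ZFSet.{u}) : isOrdinal (ck x : BName B) = prop (isOrdinal x) := by
  rw [isOrdinal, isOrdinal, ← prop_inf, isTransitive_ck,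
    allIn_ck (fun z => isTransitive_ck z)]

theorem isSucc_ck (y x : ZFSet.{u}) : isSucc (ck y : BName B) (ck x) = prop (isSucc y x) := by
  refine iInf_iffB_ck (fun t => sup_le (std_of_mem_ck le_rfl) (le_std le_rfl)) (fun t => ?_) y
  rw [eq_ck, mem_ck, prop_sup]

theorem isLimit_ck (x : ZFSet.{u}) : isLimit (ck x : BName B) = prop (isLimit x) := by
  rw [isLimit, isLimit, ← prop_inf, ← prop_inf, ← prop_compl, isOrdinal_ck, isEmptyB_ck,
    allIn_ck (fun y => exIn_ck (fun z => mem_ck y z) x)]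

end Absoluteness

/-! ### Descent of inaccessibility to the ground model -/

/-- A ground-model function is still a function in the extension, and the existence of a bound below
`κ` is a bounded formula, hence absolute. -/
theorem isRegular_of_forced {κ : ZFSet.{u}} (ha : a ≠ ⊥) (h : a ≤ isRegular (ck κ : BName B)) :
    isRegular κ := by
  have h₁ := h.trans inf_le_left
  have h₂ := h.trans inf_le_right
  rw [isLimit_ck] at h₁
  refine ⟨of_le_prop ha h₁, allIn_iff.2 fun α hα => ?_⟩
  rw [iInf_Prop_eq]
  intro f
  rw [himp_iff_imp]
  intro hf
  have h₃ := le_himp_elim ((allIn_ck_elim h₂ hα).trans (iInf_le _ (ck f)))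
    (by rw [isFunction_ck]; exact le_prop hf)
  rw [exIn_ck (χ := fun β => allIn α fun ξ => allIn κ fun η => relB f ξ η ⇨ η ∈ᴮ β)
    (fun β => allIn_ck (fun ξ => allIn_ck (fun η => by rw [relB_ck, mem_ck, prop_himp]) _) _)] at h₃
  exact of_le_prop ha h₃

/-- the power set of a name -/
def pow (x : BName B) : BName B :=
  mk (x.Idx → B) (fun s => mk x.Idx x.elt fun i => x.coeff i ⊓ s i) fun _ => ⊤

theorem isPowerset_pow (x : BName B) : a ≤ isPowerset (pow x) x := by
  refine le_iInf fun z => le_iffB_intro (fun b _ hz => ?_) fun b _ hz => ?_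
  · refine mem_elim hz fun s c _ _ e => le_allIn_intro fun t d hd ht => ?_
    refine mem_elim (mem_congr_right (hd.trans e) ht) fun i c' _ hi e' => ?_
    exact mem_congr_left (symm e') (elt_mem (x := x) i (hi.trans inf_le_left))
  -- A subset `z` of `x` is determined by the Boolean values with which the names in the domain of
  -- `x` belong to it.
  · have key : b ≤ z ≈ᴮ (pow x).elt fun i => x.elt i ∈ᴮ z := by
      refine eq_of_mem_iff (fun t c hc ht => ?_) fun t c hc ht => ?_
      · refine mem_elim (allIn_elim (hc.trans hz) t ht) fun i d hd hi e => ?_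
        refine mem_congr_left (symm e) (elt_mem (x := (pow x).elt _) i (le_inf hi ?_))
        exact mem_congr_left e (hd.trans ht)
      · refine mem_elim ht fun i d _ hi e => ?_
        exact mem_congr_left (symm e) (hi.trans inf_le_right)
    exact mem_congr_left (symm key) (elt_mem (x := pow x) _ le_top)

theorem isRelation_elim {R X Y x y : BName B} (h : a ≤ isRelation R X Y) (hx : a ≤ relB R x y) :
    a ≤ x ∈ᴮ X ⊓ y ∈ᴮ Y := by
  rw [relB_eq] at hx
  refine exIn_elim (allIn_elim h _ hx) fun x' b _ hx' h' => exIn_elim h' fun y' c hc hy' e => ?_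
  rw [isPair_eq] at e
  exact le_inf (mem_congr_left (symm (pair_eq_left e)) (hc.trans hx'))
    (mem_congr_left (symm (pair_eq_right e)) hy')

theorem isInjection_mono {f X Y Y' : BName B} (h : a ≤ isInjection f X Y)
    (hY : a ≤ subsetB Y Y') : a ≤ isInjection f X Y' := by
  have hr : a ≤ isRelation f X Y := h.trans (inf_le_left.trans inf_le_left)
  have hf := h.trans (inf_le_left.trans inf_le_right)
  refine le_inf (le_inf ?_ ?_) ?_
  · refine le_allIn_intro fun z b hb hz => exIn_elim (allIn_elim (hb.trans hr) z hz)
      fun x c hc hx h' => le_exIn_intro x hx ?_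
    exact exIn_elim h' fun y d hd hy e =>
      le_exIn_intro y (allIn_elim (hd.trans (hc.trans (hb.trans hY))) y hy) e
  · refine le_allIn_intro fun x b hb hx => exIn_elim (allIn_elim (hb.trans hf) x hx)
      fun y c hc hy h' => ?_
    refine le_exIn_intro y (allIn_elim (hc.trans (hb.trans hY)) y hy)
      (le_inf (h'.trans inf_le_left) ?_)
    refine le_allIn_intro fun y' d hd _ => le_himp_intro fun e he hy' => ?_
    refine le_himp_elim (allIn_elim (he.trans (hd.trans (h'.trans inf_le_right))) y' ?_) hy'
    exact (isRelation_elim (he.trans (hd.trans (hc.trans (hb.trans hr)))) hy').trans inf_le_right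
  · refine le_allIn_intro fun x b hb hx => le_allIn_intro fun x' c hc hx' =>
      le_allIn_intro fun y d hd _ => le_himp_intro fun e he hy => ?_
    have hea := he.trans (hd.trans (hc.trans hb))
    have h₁ := allIn_elim (hea.trans (h.trans inf_le_right)) x (he.trans (hd.trans (hc.trans hx)))
    have h₂ := allIn_elim h₁ x' (he.trans (hd.trans hx'))
    refine le_himp_elim (allIn_elim h₂ y ?_) hy
    exact (isRelation_elim (hea.trans hr) (hy.trans inf_le_left)).trans inf_le_right

/-- The power set of `α` may grow in the extension, but it still includes the ground-model one, so a
forbidden injection of the ground model remains forbidden. -/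
theorem isStrongLimit_of_forced {κ : ZFSet.{u}} (ha : a ≠ ⊥)
    (h : a ≤ isStrongLimit (ck κ : BName B)) : isStrongLimit κ := by
  refine allIn_iff.2 fun α hα => ?_
  rw [iInf_Prop_eq]
  intro p
  rw [himp_iff_imp, iInf_Prop_eq]
  intro hp f hf
  have h₁ := le_himp_elim ((allIn_ck_elim h hα).trans (iInf_le _ (pow (ck α))))
    (isPowerset_pow (ck α))
  refine ha (le_bot_iff.1 (le_compl_elim (h₁.trans (iInf_le _ (ck f))) ?_))
  refine isInjection_mono (Y := ck p) (by rw [isInjection_ck]; exact le_prop hf) ?_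
  refine le_allIn_ck fun x hx => iffB_mpr ((isPowerset_pow (ck α)).trans (iInf_le _ (ck x))) ?_
  rw [subsetB_ck]
  refine le_prop ?_
  rw [isPowerset, iInf_Prop_eq] at hp
  exact (iffB_iff.1 (hp x)).1 hx

theorem isInaccessible_of_forced {κ : ZFSet.{u}} (ha : a ≠ ⊥)
    (h : a ≤ isInaccessible (ck κ : BName B)) : isInaccessible κ := by
  refine ⟨⟨isRegular_of_forced ha (h.trans (inf_le_left.trans inf_le_left)), ?_⟩,
    isStrongLimit_of_forced ha (h.trans inf_le_right)⟩
  have := h.trans (inf_le_left.trans inf_le_right)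
  rw [exIn_ck isLimit_ck] at this
  exact of_le_prop ha this

/-! ### Trees of the ground model in the extension -/

/-- The tree and its height function lie in the ground model, so forcing adds no nodes to a level.
-/
theorem isLevel_ck_le (T h α : ZFSet.{u}) (ℓ : BName B) :
    isLevel (ck T) (ck h) (ck α) ℓ ≤ ℓ ≈ᴮ ck (T.sep fun t => relB h t α) := by
  refine eq_of_mem_iff (fun t b hb ht => ?_) fun t b hb ht => ?_
  · have h₁ := iffB_mp (hb.trans (iInf_le _ t)) ht
    refine mem_ck_elim (h₁.trans inf_le_left) fun x hx c hc e => mem_congr_left (symm e) ?_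
    have h₂ := Ext.congr (φ := fun t => relB (ck h) t (ck α)) e (hc.trans (h₁.trans inf_le_right))
    rw [relB_ck] at h₂
    exact le_prop_elim h₂ fun h₃ => ck_mem_ck (ZFSet.mem_sep.2 ⟨hx, h₃⟩)
  · refine iffB_mpr (hb.trans (iInf_le _ t)) (mem_ck_elim ht fun x hx c _ e => ?_)
    rw [ZFSet.mem_sep] at hx
    refine le_inf (mem_congr_left (symm e) (ck_mem_ck hx.1)) ?_
    refine Ext.congr (φ := fun t => relB (ck h) t (ck α)) (symm e) ?_
    rw [relB_ck]
    exact le_prop hx.2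

/-- All clauses are absolute except the smallness of levels, which persists upward: levels do not
change, and an injection witnessing the size of one survives. -/
theorem isKappaTree_ck {κ T L h : ZFSet.{u}} (H : isKappaTree κ T L h) :
    a ≤ isKappaTree (ck κ : BName B) (ck T) (ck L) (ck h) := by
  obtain ⟨⟨⟨⟨⟨⟨⟨h₁, h₂⟩, h₃⟩, h₄⟩, h₅⟩, h₆⟩, h₇⟩, h₈⟩ := H
  refine le_inf (le_inf (le_inf (le_inf (le_inf (le_inf (le_inf ?_ ?_) ?_) ?_) ?_) ?_) ?_) ?_
  · rw [isRelation_ck]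
    exact le_prop h₁
  · rw [allIn_ck fun x => by rw [relB_ck, prop_compl]]
    exact le_prop h₂
  · rw [allIn_ck fun x => allIn_ck (fun y => allIn_ck (fun z => by
      rw [relB_ck, relB_ck, relB_ck, prop_inf, prop_himp]) _) _]
    exact le_prop h₃
  · rw [allIn_ck fun x => allIn_ck (fun y => allIn_ck (fun z => by
      rw [relB_ck, relB_ck, relB_ck, relB_ck, eq_ck, prop_inf, prop_sup, prop_sup, prop_himp]) _) _]
    exact le_prop h₄
  · rw [isFunction_ck]
    exact le_prop h₅
  · rw [allIn_ck fun t => allIn_ck (fun α => by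
      rw [relB_ck, iInf_iffB_ck
        (χ := fun β => exIn T fun s => relB L s t ⊓ relB h s β) ?_ ?_, prop_himp]
      · refine fun β => exIn_elim le_rfl fun s b _ _ hs => ?_
        have := hs.trans inf_le_right
        rw [relB_eq] at this
        exact std_right_of_pair_mem this
      · exact fun β => exIn_ck (fun s => by rw [relB_ck, relB_ck, prop_inf]) _) _]
    exact le_prop h₆
  · rw [allIn_ck fun α => exIn_ck (fun t => relB_ck h t α) _]
    exact le_prop h₇
  · refine le_allIn_ck fun α hα => le_iInf fun ℓ => le_himp_intro fun b _ hb => ?_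
    have h₈' := allIn_iff.1 h₈ α hα
    rw [iInf_Prop_eq] at h₈'
    have h₉ := h₈' (T.sep fun t => relB h t α)
    rw [himp_iff_imp] at h₉
    have h₁₀ := h₉ (by simp [isLevel, iffB_iff, mem_iff_zf])
    obtain ⟨μ, hμ, hf⟩ := exIn_iff.1 h₁₀
    rw [iSup_Prop_eq] at hf
    obtain ⟨f, hf⟩ := hf
    refine le_exIn_intro (ck μ) (ck_mem_ck hμ) (le_iSup_of_le (ck f) ?_)
    refine Ext.congr (φ := fun ℓ => isInjection (ck f) ℓ (ck μ))
      (symm (hb.trans (isLevel_ck_le T h α ℓ))) ?_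
    rw [isInjection_ck]
    exact le_prop hf

end BName

/-! ### Ordinals of the ground model -/

theorem isOrdinal_toZFSet (o : Ordinal.{u}) : isOrdinal o.toZFSet := by
  refine ⟨allIn_iff.2 fun x hx => allIn_iff.2 fun y hy => ?_,
    allIn_iff.2 fun x hx => allIn_iff.2 fun y hy => allIn_iff.2 fun z hz => ?_⟩
  · exact (ZFSet.isOrdinal_toZFSet o).mem_trans hy hx
  · exact ((ZFSet.isOrdinal_toZFSet o).mem hx).mem_trans hz hy

theorem isLimit_toZFSet {o : Ordinal.{u}} (ho : Order.IsSuccLimit o) : isLimit o.toZFSet := by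
  refine ⟨⟨isOrdinal_toZFSet o, ?_⟩, allIn_iff.2 fun x hx => ?_⟩
  · rw [compl_iff_not, isEmptyB, iInf_Prop_eq]
    exact fun h => h (0 : Ordinal.{u}).toZFSet (Ordinal.toZFSet_mem_toZFSet_iff.2 ho.pos)
  · obtain ⟨β, hβ, rfl⟩ := Ordinal.mem_toZFSet_iff.1 hx
    exact exIn_iff.2 ⟨(β + 1).toZFSet, Ordinal.toZFSet_mem_toZFSet_iff.2 (ho.add_one_lt hβ),
      Ordinal.toZFSet_mem_toZFSet_iff.2 (lt_add_one β)⟩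

theorem isEmptyB_toZFSet_zero : isEmptyB (0 : Ordinal.{u}).toZFSet := by
  simp [isEmptyB, mem_iff_zf]

theorem isSucc_toZFSet (o : Ordinal.{u}) : isSucc (o + 1).toZFSet o.toZFSet := by
  simp [isSucc, iffB_iff, mem_iff_zf, eq_iff_zf, or_comm]

/-- The stages at which the second player moves. -/
noncomputable def Turn (α : Ordinal.{u}) : Prop :=
  Ordinal.limitRecOn (motive := fun _ => Prop) α False (fun _ h => ¬ h) fun _ _ _ => True

theorem not_turn_zero : ¬ Turn (0 : Ordinal.{u}) := by
  rw [Turn, Ordinal.limitRecOn_zero]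
  exact not_false

theorem turn_add_one (α : Ordinal.{u}) : Turn (α + 1) ↔ ¬ Turn α := by
  rw [Turn, Ordinal.limitRecOn_add_one]
  rfl

theorem turn_of_isSuccLimit {α : Ordinal.{u}} (h : Order.IsSuccLimit α) : Turn α := by
  rw [Turn, Ordinal.limitRecOn_limit _ _ _ _ h]
  trivial

/-- Transfinite dependent choice. -/
theorem exists_ordinal_seq {X : Type w} [Nonempty X]
    (Φ : Ordinal.{u} → (Ordinal.{u} → X) → X → Prop)
    (hcongr : ∀ α q q' x, (∀ β < α, q β = q' β) → Φ α q x → Φ α q' x) (δ : Ordinal.{u})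
    (hstep : ∀ α ≤ δ, ∀ q, (∀ β < α, Φ β q (q β)) → ∃ x, Φ α q x) :
    ∃ q : Ordinal.{u} → X, ∀ α ≤ δ, Φ α q (q α) := by
  classical
  -- The values at `α` and above are arbitrary; `hcongr` makes them irrelevant.
  let ext (α : Ordinal.{u}) (g : ∀ β, β < α → X) (β : Ordinal.{u}) : X :=
    if h : β < α then g β h else Classical.arbitrary X
  let F (α : Ordinal.{u}) (g : ∀ β, β < α → X) : X := Classical.epsilon (Φ α (ext α g))
  let q : Ordinal.{u} → X := Ordinal.lt_wf.fix F
  have hq (α : Ordinal.{u}) : q α = Classical.epsilon (Φ α (ext α fun β _ => q β)) :=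
    Ordinal.lt_wf.fix_eq F α
  have hext (α : Ordinal.{u}) : ∀ β < α, ext α (fun β _ => q β) β = q β := fun β hβ => dif_pos hβ
  refine ⟨q, fun α => ?_⟩
  induction α using WellFoundedLT.induction with
  | ind α ih =>
    intro hα
    obtain ⟨x, hx⟩ := hstep α hα q fun β hβ => ih β hβ (hβ.le.trans hα)
    have hx' := hcongr α q (ext α fun β _ => q β) x (fun β hβ => (hext α β hβ).symm) hx
    rw [hq α]
    exact hcongr α _ _ _ (hext α) (Classical.epsilon_spec ⟨x, hx'⟩)

namespace BName

variable {B : Type u} [CompleteBooleanAlgebra B] {a ψ : B}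

/-! ### Mixing and the maximum principle -/

/-- The union of the names, with the elements of `x i` weighted down by `c i`; below `c i` the
contributions of the other indices vanish by disjointness. -/
theorem exists_mix {ι : Type u} (c : ι → B) (x : ι → BName B)
    (hc : ∀ i j, i ≠ j → c i ⊓ c j = ⊥) : ∃ m : BName B, ∀ i, c i ≤ m ≈ᴮ x i := by
  refine ⟨mk (Σ i, (x i).Idx) (fun s => (x s.1).elt s.2) fun s => c s.1 ⊓ (x s.1).coeff s.2,
    fun i => eq_of_mem_iff (fun z b hb hz => ?_) fun z b hb hz => ?_⟩
  · refine mem_elim hz fun s d hd hs e => ?_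
    obtain ⟨j, k⟩ := s
    have hj : d ≤ c j := hs.trans inf_le_left
    have hk : d ≤ (x j).coeff k := hs.trans inf_le_right
    by_cases hij : i = j
    · subst hij
      exact mem_congr_left (symm e) (elt_mem k hk)
    · exact (le_inf (hd.trans hb) hj).trans ((hc i j hij).le.trans bot_le)
  · refine mem_elim hz fun k d hd hk e => ?_
    exact mem_congr_left (symm e) (elt_mem (x := mk (Σ i, (x i).Idx)
      (fun s => (x s.1).elt s.2) fun s => c s.1 ⊓ (x s.1).coeff s.2) ⟨i, k⟩
      (le_inf (hd.trans hb) hk))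

/-- The default `y` off both values keeps a mixture of conditions of `Q` a condition everywhere. -/
theorem exists_mix_two {c c' : B} (h : c ⊓ c' = ⊥) (x x' y : BName B) :
    ∃ m : BName B, c ≤ m ≈ᴮ x ∧ c' ≤ m ≈ᴮ x' ∧ (c ⊔ c')ᶜ ≤ m ≈ᴮ y := by
  have h₁ : c ⊓ (c ⊔ c')ᶜ = ⊥ :=
    le_bot_iff.1 ((inf_le_inf_right _ le_sup_left).trans inf_compl_eq_bot.le)
  have h₂ : c' ⊓ (c ⊔ c')ᶜ = ⊥ :=
    le_bot_iff.1 ((inf_le_inf_right _ le_sup_right).trans inf_compl_eq_bot.le)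
  obtain ⟨m, hm⟩ := exists_mix (ι := ULift (Fin 3)) (fun i => ![c, c', (c ⊔ c')ᶜ] i.down)
    (fun i => ![x, x', y] i.down) (by
      rintro ⟨i⟩ ⟨j⟩ hij
      have hij' : i ≠ j := fun e => hij (by rw [e])
      fin_cases i <;> fin_cases j <;> simp_all [inf_comm])
  exact ⟨m, hm ⟨0⟩, hm ⟨1⟩, hm ⟨2⟩⟩

/-- Every family can be refined to an antichain with the same supremum. -/
theorem exists_disjoint_refinement {ι : Type u} (f : ι → B) :
    ∃ c : ι → B, (∀ i, c i ≤ f i) ∧ (∀ i j, i ≠ j → c i ⊓ c j = ⊥) ∧ ⨆ i, f i ≤ ⨆ i, c i := by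
  -- Well-order the indices and subtract from each term the join of the earlier ones.
  obtain ⟨_, _⟩ := exists_wellFoundedLT ι
  have key : ∀ i j, i < j → (f i ⊓ (⨆ k, ⨆ _ : k < i, f k)ᶜ) ⊓
      (f j ⊓ (⨆ k, ⨆ _ : k < j, f k)ᶜ) = ⊥ := fun i j hij => by
    refine le_bot_iff.1 (le_compl_elim (inf_le_right.trans inf_le_right) ?_)
    exact le_iSup_of_le i (le_iSup_of_le hij (inf_le_left.trans inf_le_left))
  refine ⟨fun i => f i ⊓ (⨆ k, ⨆ _ : k < i, f k)ᶜ, fun i => inf_le_left, fun i j hij => ?_,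
    iSup_le fun i => ?_⟩
  · rcases lt_or_gt_of_ne hij with h | h
    · exact key i j h
    · rw [inf_comm]; exact key j i h
  · induction i using WellFoundedLT.induction with
    | ind i ih =>
      have h₁ : f i ≤ (⨆ k, ⨆ _ : k < i, f k) ⊔ (⨆ k, ⨆ _ : k < i, f k)ᶜ := by simp
      refine le_sup_elim h₁ (fun b _ h => h.trans (iSup₂_le ih)) fun b hb h => ?_
      exact le_iSup_of_le i (le_inf hb h)

/-- The maximum principle, for a quantifier bounded by a name. -/
theorem exists_of_exIn {Q : BName B} {φ : BName B → B} [Ext φ] (h : a ≤ exIn Q φ) :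
    ∃ m : BName B, a ≤ m ∈ᴮ Q ∧ a ≤ φ m := by
  obtain ⟨c, hc, hd, hs⟩ := exists_disjoint_refinement fun i : Q.Idx => Q.coeff i ⊓ φ (Q.elt i)
  obtain ⟨m, hm⟩ := exists_mix c Q.elt hd
  have h' : a ≤ ⨆ i, c i := by
    refine le_trans (exIn_elim h fun z b _ hz hφ => mem_elim hz fun i d hd hi e => ?_) hs
    exact le_iSup_of_le i (le_inf hi (Ext.congr e (hd.trans hφ)))
  refine ⟨m, le_iSup_elim h' fun i b _ hi => ?_, le_iSup_elim h' fun i b _ hi => ?_⟩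
  · exact mem_congr_left (symm (hi.trans (hm i))) (elt_mem i (hi.trans ((hc i).trans inf_le_left)))
  · exact Ext.congr (symm (hi.trans (hm i))) (hi.trans ((hc i).trans inf_le_right))

/-! ### Plays -/

/-- the name of a sequence of names indexed by the ordinals below `α` -/
noncomputable def play (q : Ordinal.{u} → BName B) (α : Ordinal.{u}) : BName B :=
  mk α.ToType (fun i => pair (ck (Ordinal.ToType.mk.symm i).1.toZFSet)
    (q (Ordinal.ToType.mk.symm i).1)) fun _ => ⊤

variable {q : Ordinal.{u} → BName B} {α β : Ordinal.{u}}

theorem mem_play_elim {z : BName B} (h : a ≤ z ∈ᴮ play q α)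
    (h' : ∀ β < α, ∀ b ≤ a, b ≤ z ≈ᴮ pair (ck β.toZFSet) (q β) → b ≤ ψ) : a ≤ ψ :=
  mem_elim h fun i b hb _ e => h' _ (Ordinal.ToType.mk.symm i).2 b hb e

theorem pair_mem_play (hβ : β < α) : a ≤ pair (ck β.toZFSet) (q β) ∈ᴮ play q α := by
  have := elt_mem (a := a) (x := play q α) (Ordinal.ToType.mk ⟨β, hβ⟩) le_top
  simpa [play, elt] using this

theorem relB_play (hβ : β < α) : a ≤ relB (play q α) (ck β.toZFSet) (q β) := by
  rw [relB_eq]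
  exact pair_mem_play hβ

theorem relB_play_elim {y : BName B} (h : a ≤ relB (play q α) (ck β.toZFSet) y) :
    a ≤ y ≈ᴮ q β := by
  rw [relB_eq] at h
  refine mem_play_elim h fun γ _ b _ e => ?_
  have h₁ := pair_eq_left e
  rw [eq_ck] at h₁
  refine le_prop_elim h₁ fun h₂ => ?_
  obtain rfl := Ordinal.toZFSet_injective h₂
  exact pair_eq_right e

theorem play_congr {q' : Ordinal.{u} → BName B} (h : ∀ β < α, q β = q' β) :
    play q α = play q' α := by
  unfold play
  congr 1
  funext i
  rw [h _ (Ordinal.ToType.mk.symm i).2]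

/-- This inequality is enough: `follows` consults the strategy only on names already known to be
restrictions. -/
theorem isRestriction_play (hβ : β ≤ α) (s : BName B) :
    isRestriction s (play q α) (ck β.toZFSet) ≤ s ≈ᴮ play q β := by
  refine eq_of_mem_iff (fun z b hb hz => ?_) fun z b hb hz => ?_
  · have h₁ := iffB_mp (hb.trans (iInf_le _ z)) hz
    refine mem_play_elim (h₁.trans inf_le_left) fun γ _ c hc e => ?_
    refine exIn_elim (hc.trans (h₁.trans inf_le_right)) fun ξ d hd hξ h₂ =>
      le_iSup_elim h₂ fun y d' hd' h₃ => ?_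
    rw [isPair_eq] at h₃
    have h₄ := mem_congr_left (pair_eq_left (trans (symm h₃) (hd'.trans (hd.trans e))))
      (hd'.trans hξ)
    rw [mem_ck] at h₄
    refine le_prop_elim h₄ fun h₅ => ?_
    rw [mem_iff_zf, Ordinal.toZFSet_mem_toZFSet_iff] at h₅
    exact mem_congr_left (symm (hd'.trans (hd.trans e))) (pair_mem_play h₅)
  · refine iffB_mpr (hb.trans (iInf_le _ z)) (mem_play_elim hz fun γ hγ c _ e => le_inf ?_ ?_)
    · exact mem_congr_left (symm e) (pair_mem_play (hγ.trans_le hβ))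
    · refine le_exIn_intro (ck γ.toZFSet) (ck_mem_ck (Ordinal.toZFSet_mem_toZFSet_iff.2 hγ))
        (le_iSup_of_le (q γ) ?_)
      rw [isPair_eq]
      exact e

theorem isPlay_play {Q L : BName B} (hQ : ∀ β < α, a ≤ q β ∈ᴮ Q)
    (hL : ∀ β < α, ∀ γ < β, a ≤ relB L (q β) (q γ)) :
    a ≤ isPlay Q L (ck α.toZFSet) (play q α) := by
  refine le_inf (le_inf ?_ ?_) ?_
  · refine le_allIn_intro fun z b hb hz => mem_play_elim hz fun β hβ c hc e => ?_
    refine le_exIn_intro _ (ck_mem_ck (Ordinal.toZFSet_mem_toZFSet_iff.2 hβ))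
      (le_exIn_intro _ (hc.trans (hb.trans (hQ β hβ))) ?_)
    rw [isPair_eq]
    exact e
  · refine le_allIn_ck fun x hx => ?_
    obtain ⟨β, hβ, rfl⟩ := Ordinal.mem_toZFSet_iff.1 hx
    refine le_exIn_intro _ (hQ β hβ) (le_inf (relB_play hβ) ?_)
    exact le_allIn_intro fun y b _ _ => le_himp_intro fun c _ hc => relB_play_elim hc
  · refine le_allIn_ck fun x hx => le_allIn_ck fun y hy => ?_
    obtain ⟨β, hβ, rfl⟩ := Ordinal.mem_toZFSet_iff.1 hx
    obtain ⟨γ, hγ, rfl⟩ := Ordinal.mem_toZFSet_iff.1 hy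
    refine le_allIn_intro fun s b hb _ => le_allIn_intro fun t c hc _ =>
      le_himp_intro fun d hd h => ?_
    have hs := relB_play_elim (h.trans inf_le_left)
    have ht := relB_play_elim (h.trans inf_le_right)
    refine Ext.congr (φ := fun s => relB L s t) (symm hs)
      (Ext.congr (φ := fun t => relB L (q β) t) (symm ht) ?_)
    exact hd.trans (hc.trans (hb.trans (hL β hβ γ hγ)))

theorem follows_play {T σ : BName B}
    (hT : ∀ β < α, a ≤ relB σ (play q β) (q β) ∨ a ≤ (ck β.toZFSet ∈ᴮ T)ᶜ) :
    a ≤ follows T σ (ck α.toZFSet) (play q α) := by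
  refine le_allIn_ck fun x hx => ?_
  obtain ⟨β, hβ, rfl⟩ := Ordinal.mem_toZFSet_iff.1 hx
  refine le_himp_intro fun b hb hβT => le_iInf fun s => le_himp_intro fun c hc hs =>
    le_iInf fun y => le_himp_intro fun d hd hy => ?_
  rcases hT β hβ with h | h
  · refine Ext.congr (φ := fun s => relB σ s y)
      (symm (hd.trans (hs.trans (isRestriction_play hβ.le s)))) ?_
    exact Ext.congr (φ := fun y => relB σ (play q β) y) (symm (relB_play_elim hy))
      (hd.trans (hc.trans (hb.trans h)))
  · exact le_compl_elim (hd.trans (hc.trans (hb.trans h))) (hd.trans (hc.trans hβT))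

theorem isStage_ck {δ : Ordinal.{u}} (h : α ≤ δ) :
    a ≤ isStage (ck δ.toZFSet : BName B) (ck α.toZFSet) := by
  rw [isStage, mem_ck, eq_ck, prop_sup]
  refine le_prop ?_
  rcases h.lt_or_eq with h | h
  · exact Or.inl (Ordinal.toZFSet_mem_toZFSet_iff.2 h)
  · exact Or.inr (congrArg _ h)

/-- The clauses for zero, successors and limits determine the turn set recursively, so whose turn it
is at a stage is decided in the ground model. -/
theorem mem_turnSet {δ : Ordinal.{u}} {T : BName B} (h : a ≤ isTurnSet (ck δ.toZFSet) T)
    (α : Ordinal.{u}) (hα : α ≤ δ) :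
    (Turn α → a ≤ ck α.toZFSet ∈ᴮ T) ∧ (¬ Turn α → a ≤ (ck α.toZFSet ∈ᴮ T)ᶜ) := by
  induction α using Ordinal.limitRecOn with
  | zero =>
    refine ⟨fun h => absurd h not_turn_zero, fun _ => ?_⟩
    refine le_himp_elim ((h.trans (inf_le_left.trans (inf_le_left.trans inf_le_right))).trans
      (iInf_le _ _)) ?_
    rw [isEmptyB_ck]
    exact le_prop isEmptyB_toZFSet_zero
  | add_one α ih =>
    have hα' : α ≤ δ := (lt_add_one α).le.trans hα
    have h₁ := le_himp_elim ((h.trans inf_le_right).trans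
      ((iInf_le _ (ck α.toZFSet)).trans (iInf_le _ (ck (α + 1).toZFSet))))
      (le_inf (le_inf (isStage_ck hα') (isStage_ck hα))
        (by rw [isSucc_ck]; exact le_prop (isSucc_toZFSet α)))
    rw [turn_add_one, not_not]
    refine ⟨fun ht => iffB_mpr h₁ ((ih hα').2 ht), fun ht => le_compl_intro fun b hb hb' => ?_⟩
    exact le_compl_elim (iffB_mp (hb.trans h₁) hb') (hb.trans ((ih hα').1 ht))
  | limit α hlim _ =>
    refine ⟨fun _ => ?_, fun h => absurd (turn_of_isSuccLimit hlim) h⟩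
    refine le_himp_elim ((h.trans (inf_le_left.trans inf_le_right)).trans (iInf_le _ _)) ?_
    refine le_inf (isStage_ck hα) ?_
    rw [isLimit_ck]
    exact le_prop (isLimit_toZFSet hlim)

/-- The second player's answer to a play in which she followed her winning strategy. -/
theorem exists_answer {Q L T σ : BName B} {δ : Ordinal.{u}} (hT : a ≤ isTurnSet (ck δ.toZFSet) T)
    (hσ : a ≤ isWinningStrategy Q L (ck δ.toZFSet) T σ) (hα : α ≤ δ) (ht : Turn α)
    (hQ : ∀ β < α, a ≤ q β ∈ᴮ Q) (hL : ∀ β < α, ∀ γ < β, a ≤ relB L (q β) (q γ))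
    (hf : ∀ β < α, Turn β → a ≤ relB σ (play q β) (q β)) :
    ∃ x, a ≤ x ∈ᴮ Q ∧ (∀ β < α, a ≤ relB L x (q β)) ∧ a ≤ relB σ (play q α) x := by
  have h₁ := le_himp_elim ((hσ.trans inf_le_right).trans (iInf_le _ (ck α.toZFSet)))
    (le_inf (isStage_ck hα) ((mem_turnSet hT α hα).1 ht))
  have h₂ := le_himp_elim (h₁.trans (iInf_le _ (play q α))) (le_inf (isPlay_play hQ hL)
    (follows_play fun β hβ => by
      by_cases h : Turn β
      · exact Or.inl (hf β hβ h)
      · exact Or.inr ((mem_turnSet hT β (hβ.le.trans hα)).2 h)))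
  obtain ⟨x, hx, hx'⟩ := exists_of_exIn h₂
  refine ⟨x, hx, fun β hβ => ?_, hx'.trans inf_le_left⟩
  have h₃ := allIn_ck_elim (hx'.trans inf_le_right) (Ordinal.toZFSet_mem_toZFSet_iff.2 hβ)
  exact le_himp_elim (h₃.trans (iInf_le _ (q β))) (relB_play hβ)

theorem relB_trans {Q L x y z : BName B} (h : a ≤ isForcingNotion Q L) (hx : a ≤ x ∈ᴮ Q)
    (hy : a ≤ y ∈ᴮ Q) (hz : a ≤ z ∈ᴮ Q) (hxy : a ≤ relB L x y) (hyz : a ≤ relB L y z) :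
    a ≤ relB L x z :=
  le_himp_elim (allIn_elim (allIn_elim (allIn_elim (h.trans inf_le_right) x hx) y hy) z hz)
    (le_inf hxy hyz)

theorem relB_refl {Q L x : BName B} (h : a ≤ isForcingNotion Q L) (hx : a ≤ x ∈ᴮ Q) :
    a ≤ relB L x x :=
  allIn_elim (h.trans (inf_le_left.trans inf_le_right)) x hx

/-- In a strategically closed forcing notion, the first player can meet any requirements which can
be met by extending a given condition, in a descending sequence of length `δ + 1`. -/
theorem exists_descending {Q L T σ : BName B} {δ : Ordinal.{u}} (hQL : a ≤ isForcingNotion Q L)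
    (hT : a ≤ isTurnSet (ck δ.toZFSet) T) (hσ : a ≤ isWinningStrategy Q L (ck δ.toZFSet) T σ)
    {x₀ : BName B} (hx₀ : a ≤ x₀ ∈ᴮ Q) (Φ : Ordinal.{u} → BName B → Prop)
    (hΦ : ∀ α y, a ≤ y ∈ᴮ Q → a ≤ relB L y x₀ → ∃ x, a ≤ x ∈ᴮ Q ∧ a ≤ relB L x y ∧ Φ α x) :
    ∃ q : Ordinal.{u} → BName B, ∀ α ≤ δ, a ≤ q α ∈ᴮ Q ∧ a ≤ relB L (q α) x₀ ∧
      (∀ β < α, a ≤ relB L (q α) (q β)) ∧ (¬ Turn α → Φ α (q α)) := by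
  have : Nonempty (BName B) := ⟨x₀⟩
  -- The hypothesis must also record obedience to `σ` at the second player's stages, since only then
  -- does `σ` answer at later ones.
  refine (exists_ordinal_seq (fun α q x => a ≤ x ∈ᴮ Q ∧ a ≤ relB L x x₀ ∧
    (∀ β < α, a ≤ relB L x (q β)) ∧ (Turn α → a ≤ relB σ (play q α) x) ∧ (¬ Turn α → Φ α x))
    (fun α q q' x hqq' ⟨h₁, h₂, h₃, h₄, h₅⟩ => ⟨h₁, h₂, fun β hβ => hqq' β hβ ▸ h₃ β hβ,
      fun ht => play_congr hqq' ▸ h₄ ht, h₅⟩) δ ?_).imp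
    fun q hq α hα => ⟨(hq α hα).1, (hq α hα).2.1, (hq α hα).2.2.1, (hq α hα).2.2.2.2⟩
  intro α hα q hq
  by_cases ht : Turn α
  · obtain ⟨x, hx, hL, hx'⟩ := exists_answer hT hσ hα ht (fun β hβ => (hq β hβ).1)
      (fun β hβ γ hγ => (hq β hβ).2.2.1 γ hγ) fun β hβ => (hq β hβ).2.2.2.1
    -- The second player never moves at stage `0`, so her moves lie below `q 0`, which already
    -- extends `x₀`.
    have h0 : 0 < α := pos_iff_ne_zero.2 fun h => not_turn_zero (h ▸ ht)
    exact ⟨x, hx, relB_trans hQL hx (hq 0 h0).1 hx₀ (hL 0 h0) (hq 0 h0).2.1, hL, fun _ => hx',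
      fun h => absurd ht h⟩
  · rcases Ordinal.zero_or_succ_or_isSuccLimit α with rfl | ⟨β, rfl⟩ | hlim
    · obtain ⟨x, hx, hL, hx'⟩ := hΦ 0 x₀ hx₀ (relB_refl hQL hx₀)
      exact ⟨x, hx, hL, fun β hβ => absurd hβ not_lt_zero, fun h => absurd h ht, fun _ => hx'⟩
    · have hβ : β < Order.succ β := Order.lt_succ β
      obtain ⟨x, hx, hL, hx'⟩ := hΦ (Order.succ β) (q β) (hq β hβ).1 (hq β hβ).2.1
      refine ⟨x, hx, relB_trans hQL hx (hq β hβ).1 hx₀ hL (hq β hβ).2.1, fun γ hγ => ?_,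
        fun h => absurd h ht, fun _ => hx'⟩
      rcases (Order.lt_succ_iff.1 hγ).lt_or_eq with h | rfl
      · exact relB_trans hQL hx (hq β hβ).1 (hq γ hγ).1 hL ((hq β hβ).2.2.1 γ h)
      · exact hL
    · exact absurd (turn_of_isSuccLimit hlim) ht

end BName

/-! ### The forcing relation -/

section RO

variable {P : Type u} [Preorder P]

/-- the element of the Boolean completion given by a condition -/
def RO.of (p : P) : RO P := Heyting.Regular.toRegular (LowerSet.Iic p)

theorem forces_iff {p : P} {φ : RO P} : Forces p φ ↔ RO.of p ≤ φ := by
  have h : RO.of p ≤ φ ↔ LowerSet.Iic p ≤ Heyting.Regular.val φ :=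
    Heyting.Regular.gi.gc (LowerSet.Iic p) φ
  rw [h, LowerSet.Iic_le]
  rfl

theorem forces_of_self (p : P) : Forces p (RO.of p) := forces_iff.2 le_rfl

theorem mem_compl_lowerSet {U : LowerSet P} {p : P} : p ∈ Uᶜ ↔ ∀ q ≤ p, q ∉ U := by
  rw [← LowerSet.Iic_le, le_compl_iff_disjoint_right, disjoint_iff_inf_le]
  constructor
  · exact fun h q hq hqU => h ⟨hq, hqU⟩
  · exact fun h q hq => h q hq.1 hq.2

/-- `RO.of p` is the double complement of the cone below `p`. Without separativity, a condition
forcing it need not lie in the cone, but the cone is dense below it. -/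
theorem exists_le_of_forces_of {p q : P} (h : Forces q (RO.of p)) : ∃ s ≤ q, s ≤ p := by
  have h' : q ∈ (LowerSet.Iic p)ᶜᶜ := h
  rw [mem_compl_lowerSet] at h'
  by_contra! hc
  refine h' q le_rfl (mem_compl_lowerSet.2 fun s hs hsp => hc s hs hsp)

theorem not_forces_bot (p : P) : ¬ Forces p (⊥ : RO P) := fun h => h

theorem exists_forces {φ : RO P} (h : φ ≠ ⊥) : ∃ p, Forces p φ := by
  by_contra! hc
  exact h (le_bot_iff.1 fun p hp => hc p hp)

theorem of_ne_bot (p : P) : RO.of p ≠ ⊥ := fun h =>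
  not_forces_bot p (h ▸ forces_of_self p)

theorem Forces.exists_of_iSup {ι : Sort w} {p : P} {f : ι → RO P} (h : Forces p (⨆ i, f i)) :
    ∃ q ≤ p, ∃ i, Forces q (f i) := by
  obtain ⟨i, hi⟩ := exists_inf_ne_bot_of_le_iSup (of_ne_bot p) (forces_iff.1 h)
  obtain ⟨s, hs⟩ := exists_forces hi
  obtain ⟨q, hqs, hqp⟩ := exists_le_of_forces_of hs.1
  exact ⟨q, hqp, i, Forces.mono hqs hs.2⟩

theorem of_inf_of_eq_bot {p q : P} (h : ¬ ∃ s : P, s ≤ p ∧ s ≤ q) : RO.of p ⊓ RO.of q = ⊥ := by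
  by_contra hc
  obtain ⟨s, hs⟩ := exists_forces hc
  obtain ⟨s', h₁, h₂⟩ := exists_le_of_forces_of hs.1
  obtain ⟨s'', h₃, h₄⟩ := exists_le_of_forces_of (Forces.mono h₁ hs.2)
  exact h ⟨s'', h₃.trans h₂, h₄⟩

theorem of_mono {p q : P} (h : p ≤ q) : RO.of p ≤ RO.of q :=
  forces_iff.1 (Forces.mono h (forces_of_self q))

/-- A minimal element of a finite preorder would lie below both members of any pair of its
extensions. Infinitude makes `δ` uncountable in `exists_stage`. -/
theorem NontrivialForcing.infinite [Nonempty P] (h : NontrivialForcing P) : Infinite P := by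
  by_contra hfin
  rw [not_infinite_iff_finite] at hfin
  obtain ⟨m, hm⟩ := (Set.finite_univ (α := P)).exists_minimal Set.univ_nonempty
  obtain ⟨q, hq, r, hr, hqr⟩ := h m
  exact hqr ⟨m, hm.2 trivial hq, hm.2 trivial hr⟩

end RO

/-! ### Branches are not added -/

/-- An injection of a small forcing notion into the stages at which the first player moves. -/
theorem exists_stage {P : Type u} {δ : Cardinal.{u}} [Infinite P] (hδ : Cardinal.mk P < δ) :
    ∃ st : P → Ordinal.{u}, Function.Injective st ∧ ∀ p, st p < δ.ord ∧ ¬ Turn (st p) := by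
  have hω : Cardinal.aleph0 ≤ δ := (Cardinal.aleph0_le_mk P).trans hδ.le
  have hω' : Ordinal.omega0 < δ.ord := by
    rw [Cardinal.lt_ord, Ordinal.card_omega0]
    exact (Cardinal.aleph0_le_mk P).trans_lt hδ
  have hlim := Cardinal.isSuccLimit_ord hω
  have hle : Cardinal.mk P ≤ Cardinal.mk δ.ord.ToType := by
    rw [Cardinal.mk_ord_toType]; exact hδ.le
  obtain ⟨i⟩ := hle
  let j : P → Ordinal.{u} := fun p => (Ordinal.ToType.mk.symm (i p)).1
  have hj : Function.Injective j := fun p p' h =>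
    i.injective (Ordinal.ToType.mk.symm.injective (Subtype.ext h))
  -- The successor of a nonzero limit is a first-player stage; the inner `+ 1` excludes zero. The
  -- stage stays below `δ.ord`, because initial ordinals above `ω` are closed under multiplication.
  refine ⟨fun p => Ordinal.omega0 * (j p + 1) + 1, fun p p' h => hj ?_, fun p => ⟨?_, ?_⟩⟩
  · have h₁ : Order.succ (Ordinal.omega0 * Order.succ (j p)) =
        Order.succ (Ordinal.omega0 * Order.succ (j p')) := h
    exact Order.succ_injective ((Ordinal.isNormal_mul_right Ordinal.omega0_pos).strictMono.injective
      (Order.succ_injective h₁))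
  · refine hlim.add_one_lt (Ordinal.isPrincipal_mul_ord hω hω' (hlim.add_one_lt ?_))
    exact (Ordinal.ToType.mk.symm (i p)).2
  · rw [turn_add_one, not_not]
    exact turn_of_isSuccLimit (Ordinal.isSuccLimit_mul_left Ordinal.isSuccLimit_omega0
      (by simp))

section Iteration

variable {P : Type u} [Preorder P] {Q : PosetName P}

open BName

theorem Iteration.mem (c : Iteration P Q) : RO.of c.fst ≤ c.snd ∈ᴮ Q.carrier :=
  forces_iff.1 c.forces_mem

theorem PosetName.le_isForcing (Q : PosetName P) (a : RO P) :
    a ≤ isForcingNotion Q.carrier Q.order := Q.isForcing ▸ le_top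

/-- A name for a condition of `Q` is, below some condition, one of the names used in `P * Q`. -/
theorem exists_iteration_condition {p : P} {y : BName (RO P)} (h : RO.of p ≤ y ∈ᴮ Q.carrier) :
    ∃ c : Iteration P Q, c.fst ≤ p ∧ RO.of c.fst ≤ y ≈ᴮ c.snd := by
  rw [mem_def] at h
  obtain ⟨s, hs, i, hi⟩ := Forces.exists_of_iSup (forces_iff.2 h)
  exact ⟨⟨s, i, Forces.of_le (elt_mem i le_rfl) hi.1⟩, hs, forces_iff.1 hi.2⟩

variable {τ : Type w} {ht : τ → Ordinal.{u}} {C : τ → τ → Prop} {F : Iteration P Q → τ → Prop}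
  {x₀ : Iteration P Q} {κ : Ordinal.{u}}

/-- If no two extensions of `x` and `x'` force incomparable nodes into the branch, then the nodes
which extensions of `x` force into the branch form a branch. -/
theorem exists_branch_of_no_splitting
    (hC : ∀ t₁ t₂ t', C t₁ t' → C t₂ t' → ht t₁ ≤ ht t' → ht t₂ ≤ ht t' → C t₁ t₂)
    (hκ : ∀ t, ht t < κ)
    (hlevel : ∀ x ≤ x₀, ∀ α < κ, ∃ y ≤ x, ∃ t, ht t = α ∧ F y t)
    {x x' : Iteration P Q} (hx : x ≤ x₀) (hx' : x' ≤ x₀)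
    (h : ∀ y ≤ x, ∀ y' ≤ x', ∀ t t', F y t → F y' t' → C t t') :
    ∃ S : Set τ, (∀ t ∈ S, ∀ t' ∈ S, C t t') ∧ ∀ α < κ, ∃ t ∈ S, ht t = α := by
  refine ⟨{t | ∃ y ≤ x, F y t}, ?_, fun α hα => ?_⟩
  · rintro t₁ ⟨y₁, hy₁, hF₁⟩ t₂ ⟨y₂, hy₂, hF₂⟩
    -- One node forced in below `x'`, at least as high as both `t₁` and `t₂`, is comparable with
    -- each.
    obtain ⟨y', hy', t', ht', hF'⟩ := hlevel x' hx' (max (ht t₁) (ht t₂)) (max_lt (hκ _) (hκ _))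
    exact hC t₁ t₂ t' (h y₁ hy₁ y' hy' t₁ t' hF₁ hF') (h y₂ hy₂ y' hy' t₂ t' hF₂ hF')
      (ht' ▸ le_max_left _ _) (ht' ▸ le_max_right _ _)
  · obtain ⟨y, hy, t, ht, hF⟩ := hlevel x hx α hα
    exact ⟨t, ⟨y, hy, hF⟩, ht⟩

/-- Below `p`, the name `x` forces two incomparable nodes into the branch. -/
def Splits (F : Iteration P Q → τ → Prop) (C : τ → τ → Prop) (p : P) (x : BName (RO P))
    (t t' : τ) : Prop :=
  ∃ c c' : Iteration P Q, c.fst ≤ p ∧ c'.fst ≤ p ∧ RO.of c.fst ≤ x ≈ᴮ c.snd ∧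
    RO.of c'.fst ≤ x ≈ᴮ c'.snd ∧ F c t ∧ F c' t' ∧ ¬ C t t'

/-- The first player's move for `p`. Extensions of `y` over two incompatible conditions below `p`
force incomparable nodes; incompatibility lets one name equal each of them in turn, and equal `y`
elsewhere. -/
theorem exists_splits (hP : NontrivialForcing P)
    (hsplit : ∀ x ≤ x₀, ∀ x' ≤ x₀, ∃ y ≤ x, ∃ y' ≤ x', ∃ t t', F y t ∧ F y' t' ∧ ¬ C t t')
    {p : P} (hp : p ≤ x₀.fst) {y : BName (RO P)} (hy : RO.of x₀.fst ≤ y ∈ᴮ Q.carrier)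
    (hyx : RO.of x₀.fst ≤ relB Q.order y x₀.snd) :
    ∃ x, RO.of x₀.fst ≤ x ∈ᴮ Q.carrier ∧ RO.of x₀.fst ≤ relB Q.order x y ∧
      ∃ t t', Splits F C p x t t' := by
  obtain ⟨s, hs, s', hs', hinc⟩ := hP p
  have below : ∀ s ≤ p, ∃ d : Iteration P Q, d ≤ x₀ ∧ d.fst ≤ s ∧ RO.of d.fst ≤ y ≈ᴮ d.snd := by
    intro s hs
    obtain ⟨d, hd, e⟩ := exists_iteration_condition ((of_mono (hs.trans hp)).trans hy)
    have hd₀ := hd.trans (hs.trans hp)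
    exact ⟨d, ⟨hd₀, forces_iff.2 (Ext.congr (φ := fun y => relB Q.order y x₀.snd) e
      ((of_mono hd₀).trans hyx))⟩, hd, e⟩
  obtain ⟨d, hd₀, hds, e⟩ := below s hs
  obtain ⟨d', hd₀', hds', e'⟩ := below s' hs'
  obtain ⟨c, hc, c', hc', t, t', hF, hF', hCt⟩ := hsplit d hd₀ d' hd₀'
  have hcd : RO.of c.fst ⊓ RO.of c'.fst = ⊥ := of_inf_of_eq_bot fun ⟨r, hr, hr'⟩ =>
    hinc ⟨r, hr.trans (hc.1.trans hds), hr'.trans (hc'.1.trans hds')⟩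
  obtain ⟨m, hm, hm', hm''⟩ := exists_mix_two hcd c.snd c'.snd y
  have cases : ∀ {φ : RO P}, (RO.of c.fst ≤ φ) → (RO.of c'.fst ≤ φ) →
      (∀ b ≤ RO.of x₀.fst, b ≤ m ≈ᴮ y → b ≤ φ) → RO.of x₀.fst ≤ φ := by
    intro φ h₁ h₂ h₃
    have htop : RO.of x₀.fst ≤ (RO.of c.fst ⊔ RO.of c'.fst) ⊔ (RO.of c.fst ⊔ RO.of c'.fst)ᶜ := by
      rw [sup_compl_eq_top]; exact le_top
    exact le_sup_elim htop (fun b _ h => h.trans (sup_le h₁ h₂))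
      fun b hb h => h₃ b hb (h.trans hm'')
  have hrel : ∀ {c d : Iteration P Q}, c ≤ d → RO.of d.fst ≤ y ≈ᴮ d.snd →
      RO.of c.fst ≤ m ≈ᴮ c.snd → RO.of c.fst ≤ relB Q.order m y := fun {c d} hcd e hm =>
    Ext.congr (φ := fun m => relB Q.order m y) (symm hm)
      (Ext.congr (φ := fun y => relB Q.order c.snd y) (symm ((of_mono hcd.1).trans e))
        (forces_iff.1 hcd.2))
  refine ⟨m, cases (mem_congr_left (symm hm) c.mem) (mem_congr_left (symm hm') c'.mem)
    fun b hb h => mem_congr_left (symm h) (hb.trans hy), cases (hrel hc e hm) (hrel hc' e' hm')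
    fun b hb h => ?_, t, t', c, c', hc.1.trans (hds.trans hs), hc'.1.trans (hds'.trans hs'),
    hm, hm', hF, hF', hCt⟩
  exact Ext.congr (φ := fun m => relB Q.order m y) (symm h)
    (relB_refl (Q.le_isForcing b) (hb.trans hy))

/-- A branch added by `P * Q` to a tree of the ground model yields a branch of the ground model,
when `P` is small and nontrivial and `Q` is strategically closed. -/
theorem exists_branch_of_gap {δ : Cardinal.{u}} (hP : NontrivialForcing P)
    (hPδ : Cardinal.mk P < δ)
    (hQ : ∀ p : P, Forces p (stratClosed Q.carrier Q.order (checkOrd δ.ord)))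
    (hC : ∀ t₁ t₂ t', C t₁ t' → C t₂ t' → ht t₁ ≤ ht t' → ht t₂ ≤ ht t' → C t₁ t₂)
    (hκ : ∀ t, ht t < κ)
    (hreg : ∀ g : Ordinal.{u} → Ordinal.{u}, (∀ ξ < δ.ord, g ξ < κ) →
      ∃ β < κ, ∀ ξ < δ.ord, g ξ < β)
    (hmono : ∀ x y t, y ≤ x → F x t → F y t)
    (hcompat : ∀ y ≤ x₀, ∀ t t', F y t → F y t' → C t t')
    (hlevel : ∀ x ≤ x₀, ∀ α < κ, ∃ y ≤ x, ∃ t, ht t = α ∧ F y t) :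
    ∃ S : Set τ, (∀ t ∈ S, ∀ t' ∈ S, C t t') ∧ ∀ α < κ, ∃ t ∈ S, ht t = α := by
  by_contra hno
  have : Nonempty P := ⟨x₀.fst⟩
  have : Infinite P := hP.infinite
  obtain ⟨st, hst, hst'⟩ := exists_stage hPδ
  -- it suffices to work below a condition which decides the strategy
  obtain ⟨p₁, hp₁, T, hp₁T⟩ := Forces.exists_of_iSup (hQ x₀.fst)
  obtain ⟨p₂, hp₂, σ, hp₂σ⟩ := Forces.exists_of_iSup hp₁T
  obtain ⟨x₁, hx₁, hx₁p⟩ : ∃ x₁ : Iteration P Q, x₁ ≤ x₀ ∧ x₁.fst = p₂ :=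
    ⟨⟨p₂, x₀.idx, Forces.mono (hp₂.trans hp₁) x₀.forces_mem⟩,
      ⟨hp₂.trans hp₁, forces_iff.2 (relB_refl (Q.le_isForcing _)
        (forces_iff.1 (Forces.mono (hp₂.trans hp₁) x₀.forces_mem)))⟩, rfl⟩
  subst hx₁p
  have hδ : RO.of x₁.fst ≤ (checkOrd δ.ord : BName (RO P)) ≈ᴮ ck δ.ord.toZFSet := checkOrd_eq_ck _
  have hT : RO.of x₁.fst ≤ isTurnSet (ck δ.ord.toZFSet) T :=
    Ext.congr (φ := fun d => isTurnSet d T) hδ (forces_iff.1 hp₂σ.1)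
  have hσ : RO.of x₁.fst ≤ isWinningStrategy Q.carrier Q.order (ck δ.ord.toZFSet) T σ :=
    Ext.congr (φ := fun d => isWinningStrategy Q.carrier Q.order d T σ) hδ (forces_iff.1 hp₂σ.2)
  have hsplit : ∀ x ≤ x₁, ∀ x' ≤ x₁, ∃ y ≤ x, ∃ y' ≤ x', ∃ t t', F y t ∧ F y' t' ∧ ¬ C t t' := by
    intro x hx x' hx'
    by_contra! hc
    exact hno (exists_branch_of_no_splitting hC hκ hlevel (hx.trans hx₁) (hx'.trans hx₁)
      fun y hy y' hy' t t' h h' => hc y hy y' hy' t t' h h')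
  -- Injectivity of `st` leaves at most one `p` to treat at each stage; at a stage of no such `p`
  -- the first player repeats the position.
  obtain ⟨q, hq⟩ := exists_descending (Q.le_isForcing _) hT hσ x₁.mem
    (fun α x => ∀ p ≤ x₁.fst, st p = α → ∃ t t', Splits F C p x t t') (fun α y hy hyx => by
      by_cases h : ∃ p ≤ x₁.fst, st p = α
      · obtain ⟨p, hp, rfl⟩ := h
        obtain ⟨x, hx, hxy, t, t', hs⟩ := exists_splits hP hsplit hp hy hyx
        exact ⟨x, hx, hxy, fun p' _ e => hst e ▸ ⟨t, t', hs⟩⟩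
      · exact ⟨y, hy, relB_refl (Q.le_isForcing _) hy, fun p hp e => absurd ⟨p, hp, e⟩ h⟩)
  have hsp : ∀ p ≤ x₁.fst, ∃ t t', Splits F C p (q (st p)) t t' := fun p hp =>
    (hq (st p) (hst' p).1.le).2.2.2 (hst' p).2 p hp rfl
  have : Nonempty τ := ⟨(hsp x₁.fst le_rfl).choose⟩
  choose! t t' hsp using hsp
  have hκ0 : 0 < κ := pos_of_gt (hκ (t x₁.fst))
  classical
  -- Regularity is applied to functions on `δ.ord`, so the heights are reindexed along `st`, with
  -- value `0` at stages outside its range.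
  obtain ⟨β, hβ, hβ'⟩ := hreg (fun ξ => if h : ∃ p, st p = ξ then
    max (ht (t h.choose)) (ht (t' h.choose)) else 0) (fun ξ _ => by
      split_ifs
      · exact max_lt (hκ _) (hκ _)
      · exact hκ0)
  have hmax : ∀ p, max (ht (t p)) (ht (t' p)) < β := fun p => by
    have h : ∃ p', st p' = st p := ⟨p, rfl⟩
    have := hβ' (st p) (hst' p).1
    rwa [dif_pos h, hst h.choose_spec] at this
  obtain ⟨hqQ, hqx, hqL, -⟩ := hq δ.ord le_rfl
  obtain ⟨z, hz, hze⟩ := exists_iteration_condition hqQ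
  have hzx : z ≤ x₁ := ⟨hz, forces_iff.2 (Ext.congr (φ := fun y => relB Q.order y x₁.snd) hze
    ((of_mono hz).trans hqx))⟩
  obtain ⟨y, hy, s, hs, hFs⟩ := hlevel z (hzx.trans hx₁) β hβ
  have hyp : y.fst ≤ x₁.fst := hy.1.trans hz
  -- The splitting is read off at the stage of the `P`-coordinate of `y` itself, so that `c` and
  -- `c'` refine that coordinate.
  obtain ⟨c, c', hc, hc', e, e', hFc, hFc', hCt⟩ := hsp y.fst hyp
  have key : ∀ c : Iteration P Q, ∀ r, c.fst ≤ y.fst → RO.of c.fst ≤ q (st y.fst) ≈ᴮ c.snd →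
      F c r → C r s := by
    intro c r hc e hF
    have hcz := hc.trans hy.1
    have hcx := hc.trans hyp
    have hmem : Forces c.fst (y.snd ∈ᴮ Q.carrier) := Forces.mono hc y.forces_mem
    have hmem' := forces_iff.1 hmem
    have h₁ : RO.of c.fst ≤ relB Q.order y.snd (q δ.ord) :=
      Ext.congr (φ := fun w => relB Q.order y.snd w) (symm ((of_mono hcz).trans hze))
        ((of_mono hc).trans (forces_iff.1 hy.2))
    have h₂ : RO.of c.fst ≤ relB Q.order (q δ.ord) c.snd :=
      Ext.congr (φ := fun w => relB Q.order (q δ.ord) w) e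
        ((of_mono hcx).trans (hqL (st y.fst) (hst' y.fst).1))
    have h₃ := relB_trans (Q.le_isForcing _) hmem' ((of_mono hcx).trans hqQ) c.mem h₁ h₂
    -- The `P`-coordinate of `c` with the `Q`-coordinate of `y`: it is below `y`, and below `c`
    -- because the last move lies below the move at stage `st y.fst`, which `c.fst` identifies with
    -- `c.snd`.
    let v : Iteration P Q := ⟨c.fst, y.idx, hmem⟩
    have hvc : v ≤ c := ⟨le_rfl, forces_iff.2 h₃⟩
    have hvy : v ≤ y := ⟨hc, forces_iff.2 (relB_refl (Q.le_isForcing _) hmem')⟩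
    exact hcompat v (hvy.trans (hy.trans (hzx.trans hx₁))) r s (hmono _ _ _ hvc hF)
      (hmono _ _ _ hvy hFs)
  refine hCt (hC _ _ s (key c _ hc e hFc) (key c' _ hc' e' hFc') ?_ ?_)
  · exact hs ▸ ((le_max_left _ _).trans_lt (hmax y.fst)).le
  · exact hs ▸ ((le_max_right _ _).trans_lt (hmax y.fst)).le

end Iteration

/-! ### Regularity and tree heights in the ground model. -/

open BName

theorem isFunction_iff {f x y : ZFSet.{u}} : isFunction f x y ↔
    (∀ z ∈ f, ∃ s ∈ x, ∃ t ∈ y, z = ZFSet.pair s t) ∧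
      ∀ s ∈ x, ∃ t ∈ y, ZFSet.pair s t ∈ f ∧ ∀ t' ∈ y, ZFSet.pair s t' ∈ f → t' = t := by
  simp only [isFunction, isRelation, inf_Prop_eq, allIn_iff, exIn_iff, isPair_iff, relB_iff,
    himp_iff_imp, eq_iff_zf]

/-- A regular ordinal is regular with respect to arbitrary functions on ordinals. -/
theorem isRegular.exists_bound {κ α : Ordinal.{u}} (h : isRegular κ.toZFSet) (hα : α < κ)
    (g : Ordinal.{u} → Ordinal.{u}) (hg : ∀ ξ < α, g ξ < κ) : ∃ β < κ, ∀ ξ < α, g ξ < β := by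
  let f : ZFSet.{u} := ZFSet.range fun i : α.ToType =>
    ZFSet.pair (Ordinal.ToType.mk.symm i).1.toZFSet (g (Ordinal.ToType.mk.symm i).1).toZFSet
  have hf : ∀ ξ < α, ZFSet.pair ξ.toZFSet (g ξ).toZFSet ∈ f := fun ξ hξ =>
    ZFSet.mem_range.2 ⟨Ordinal.ToType.mk ⟨ξ, hξ⟩, by simp⟩
  have h₁ := allIn_iff.1 h.2 _ (Ordinal.toZFSet_mem_toZFSet_iff.2 hα)
  rw [iInf_Prop_eq] at h₁
  have h₂ := h₁ f
  rw [himp_iff_imp] at h₂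
  have hfun : isFunction f α.toZFSet κ.toZFSet := by
    refine isFunction_iff.2 ⟨fun z hz => ?_, fun s hs => ?_⟩
    · obtain ⟨i, rfl⟩ := ZFSet.mem_range.1 hz
      have hi := (Ordinal.ToType.mk.symm i).2
      exact ⟨_, Ordinal.toZFSet_mem_toZFSet_iff.2 hi, _,
        Ordinal.toZFSet_mem_toZFSet_iff.2 (hg _ hi), rfl⟩
    · obtain ⟨ξ, hξ, rfl⟩ := Ordinal.mem_toZFSet_iff.1 hs
      refine ⟨_, Ordinal.toZFSet_mem_toZFSet_iff.2 (hg ξ hξ), hf ξ hξ, fun t' _ ht' => ?_⟩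
      obtain ⟨i, hi⟩ := ZFSet.mem_range.1 ht'
      obtain ⟨h₅, rfl⟩ := ZFSet.pair_inj.1 hi
      rw [Ordinal.toZFSet_injective h₅]
  obtain ⟨x, hx, h₃⟩ := exIn_iff.1 (h₂ hfun)
  obtain ⟨β, hβ, rfl⟩ := Ordinal.mem_toZFSet_iff.1 hx
  refine ⟨β, hβ, fun ξ hξ => ?_⟩
  have h₄ := allIn_iff.1 (allIn_iff.1 h₃ _ (Ordinal.toZFSet_mem_toZFSet_iff.2 hξ)) _
    (Ordinal.toZFSet_mem_toZFSet_iff.2 (hg ξ hξ))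
  rw [himp_iff_imp, relB_iff] at h₄
  exact Ordinal.toZFSet_mem_toZFSet_iff.1 (h₄ (hf ξ hξ))

/-- Comparability in a tree of the ground model. -/
def Comparable (L s t : ZFSet.{u}) : Prop := relB L s t ⊔ s ≈ᴮ t ⊔ relB L t s

/-- Every `κ`-tree of the ground model has a height function with values in the ordinals. -/
theorem isKappaTree.exists_height {κ : Ordinal.{u}} {T L h : ZFSet.{u}}
    (H : isKappaTree κ.toZFSet T L h) :
    ∃ ht : {t // t ∈ T} → Ordinal.{u}, (∀ t, ht t < κ) ∧
      (∀ t α, relB h t.1 α.toZFSet → α < κ → ht t = α) ∧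
      (∀ t, relB h t.1 (ht t).toZFSet) ∧
      ∀ t₁ t₂ t' : {t // t ∈ T}, Comparable L t₁ t' → Comparable L t₂ t' →
        ht t₁ ≤ ht t' → ht t₂ ≤ ht t' → Comparable L t₁ t₂ := by
  obtain ⟨⟨⟨⟨⟨⟨⟨-, -⟩, -⟩, h₄⟩, h₅⟩, h₆⟩, -⟩, -⟩ := H
  have hex : ∀ t : {t // t ∈ T}, ∃ α < κ, relB h t.1 α.toZFSet ∧
      ∀ β < κ, relB h t.1 β.toZFSet → α = β := by
    intro t
    obtain ⟨x, hx, hxt, huniq⟩ := (isFunction_iff.1 h₅).2 t.1 t.2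
    obtain ⟨α, hα, rfl⟩ := Ordinal.mem_toZFSet_iff.1 hx
    refine ⟨α, hα, relB_iff.2 hxt, fun β hβ hβt => ?_⟩
    exact (Ordinal.toZFSet_injective (huniq _ (Ordinal.toZFSet_mem_toZFSet_iff.2 hβ)
      (relB_iff.1 hβt))).symm
  choose ht hκ hrel huniq using hex
  -- The height of a node is the set of heights of its predecessors, so heights increase strictly
  -- along `L`.
  have hlt : ∀ s t : {t // t ∈ T}, relB L s.1 t.1 → ht s < ht t := by
    intro s t hst
    have h₇ := allIn_iff.1 (allIn_iff.1 h₆ t.1 t.2) _ (Ordinal.toZFSet_mem_toZFSet_iff.2 (hκ t))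
    rw [himp_iff_imp, iInf_Prop_eq] at h₇
    exact Ordinal.toZFSet_mem_toZFSet_iff.1 ((iffB_iff.1 (h₇ (hrel t) (ht s).toZFSet)).2
      (exIn_iff.2 ⟨s.1, s.2, hst, hrel s⟩))
  refine ⟨ht, hκ, fun t α h' hα => huniq t α hα h', hrel, ?_⟩
  have hle : ∀ t t' : {t // t ∈ T}, Comparable L t t' → ht t ≤ ht t' →
      relB L t.1 t'.1 ∨ t = t' := by
    rintro t t' ((h' | h') | h') hle
    · exact Or.inl h'
    · exact Or.inr (Subtype.ext h')
    · exact absurd (hlt t' t h') hle.not_gt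
  intro t₁ t₂ t' hC₁ hC₂ hle₁ hle₂
  rcases hle t₁ t' hC₁ hle₁ with h' | rfl
  · rcases hle t₂ t' hC₂ hle₂ with h'' | rfl
    · have h₇ := allIn_iff.1 (allIn_iff.1 (allIn_iff.1 h₄ t₁.1 t₁.2) t₂.1 t₂.2) t'.1 t'.2
      rw [himp_iff_imp] at h₇
      exact h₇ ⟨h', h''⟩
    · exact hC₁
  · rcases hC₂ with (h'' | h'') | h''
    · exact Or.inr h''
    · exact Or.inl (Or.inr (Eq.symm h''))
    · exact Or.inl (Or.inl h'')

/-! ### Branches of ground-model trees in the extension. -/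

section Branch

variable {B : Type u} [CompleteBooleanAlgebra B] {a : B} {κ T L h : ZFSet.{u}} {b : BName B}

/-- All nodes come from the ground model, so the statement that `b` meets level `α` is a join over
ground-model nodes, and some extension of any condition forcing it decides a node. -/
theorem isKappaBranch.le_iSup (hb : a ≤ isKappaBranch (ck κ) (ck T) (ck L) (ck h) b)
    {α : ZFSet.{u}} (hα : α ∈ κ) :
    a ≤ ⨆ t : {t : {t // t ∈ T} // relB h t.1 α}, ck t.1.1 ∈ᴮ b := by
  refine exIn_elim (allIn_ck_elim (hb.trans inf_le_right) hα) fun z c hc hz hzα => ?_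
  refine mem_ck_elim (allIn_elim (hc.trans (hb.trans (inf_le_left.trans inf_le_left))) z hz)
    fun t ht d hd e => ?_
  have h₁ := Ext.congr (φ := fun z => relB (ck h) z (ck α)) e (hd.trans hzα)
  rw [relB_ck] at h₁
  exact le_prop_elim h₁ fun h₂ => le_iSup_of_le ⟨⟨t, ht⟩, h₂⟩ (mem_congr_left e (hd.trans hz))

theorem isKappaBranch.comparable (ha : a ≠ ⊥)
    (hb : a ≤ isKappaBranch (ck κ) (ck T) (ck L) (ck h) b) {t t' : ZFSet.{u}}
    (ht : a ≤ ck t ∈ᴮ b) (ht' : a ≤ ck t' ∈ᴮ b) : Comparable L t t' := by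
  have h₁ := allIn_elim (allIn_elim (hb.trans (inf_le_left.trans inf_le_right)) _ ht) _ ht'
  rw [relB_ck, relB_ck, eq_ck, prop_sup, prop_sup] at h₁
  exact of_le_prop ha h₁

end Branch

/-- The branch is an `R`-name, but `exists_branch_of_gap` needs only which conditions of `P * Q` put
which nodes into it. The isomorphism `e` of completions supplies this by transporting Boolean
values; no name has to be translated. -/
theorem treeProperty_of_forced {R : Type u} [Preorder R] {κ : Ordinal.{u}} {δ : Cardinal.{u}}
    (hδ : δ.ord < κ) (hgap : AdmitsGapAt R δ) (hκ : isRegular κ.toZFSet) {w : RO R} (hw : w ≠ ⊥)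
    (htree : w ≤ treeProperty (ck κ.toZFSet : BName (RO R))) : treeProperty κ.toZFSet := by
  obtain ⟨P, _, Q, hP, hPδ, hQ, ⟨e⟩⟩ := hgap
  simp only [treeProperty, iInf_Prop_eq, himp_iff_imp, iSup_Prop_eq]
  intro T L h H
  have h₁ := le_himp_elim (htree.trans ((iInf_le _ (ck T)).trans
    ((iInf_le _ (ck L)).trans (iInf_le _ (ck h))))) (isKappaTree_ck H)
  obtain ⟨b, hb⟩ := exists_inf_ne_bot_of_le_iSup hw h₁
  obtain ⟨ht, hht, huniq, hrel, hC⟩ := isKappaTree.exists_height H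
  obtain ⟨x₀, hx₀⟩ := exists_forces (φ := e (isKappaBranch (ck κ.toZFSet) (ck T) (ck L) (ck h) b))
    fun h' => hb (by rw [(map_eq_bot_iff e).1 h', inf_bot_eq])
  have hcompat : ∀ y ≤ x₀, ∀ t t' : {t // t ∈ T}, Forces y (e (ck t.1 ∈ᴮ b)) →
      Forces y (e (ck t'.1 ∈ᴮ b)) → Comparable L t t' := by
    intro y hy t t' hF hF'
    have h₂ := (Forces.mono hy hx₀).inf (hF.inf hF')
    rw [← map_inf, ← map_inf] at h₂
    refine isKappaBranch.comparable (a := isKappaBranch (ck κ.toZFSet) (ck T) (ck L) (ck h) b ⊓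
      (ck t.1 ∈ᴮ b ⊓ ck t'.1 ∈ᴮ b)) (fun h₃ => ?_) inf_le_left (inf_le_right.trans inf_le_left)
      (inf_le_right.trans inf_le_right)
    rw [h₃, map_bot] at h₂
    exact not_forces_bot _ h₂
  have hlevel : ∀ x ≤ x₀, ∀ α < κ, ∃ y ≤ x, ∃ t : {t // t ∈ T}, ht t = α ∧
      Forces y (e (ck t.1 ∈ᴮ b)) := by
    intro x hx α hα
    have h₂ := e.monotone (isKappaBranch.le_iSup (a := isKappaBranch (ck κ.toZFSet) (ck T) (ck L)
      (ck h) b) le_rfl (Ordinal.toZFSet_mem_toZFSet_iff.2 hα))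
    rw [e.map_iSup] at h₂
    obtain ⟨y, hy, t, hyt⟩ := Forces.exists_of_iSup (Forces.of_le h₂ (Forces.mono hx hx₀))
    exact ⟨y, hy, t.1, huniq t.1 α t.2 hα, hyt⟩
  obtain ⟨S, hS, hS'⟩ := exists_branch_of_gap (C := fun t t' : {t // t ∈ T} => Comparable L t t')
    (F := fun x (t : {t // t ∈ T}) => Forces x (e (ck t.1 ∈ᴮ b))) hP hPδ hQ hC hht
    (fun g hg => isRegular.exists_bound hκ hδ g hg) (fun _ _ _ hy hx => Forces.mono hy hx)
    hcompat hlevel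
  refine ⟨T.sep fun t => ∃ h' : t ∈ T, (⟨t, h'⟩ : {t // t ∈ T}) ∈ S, ⟨⟨?_, ?_⟩, ?_⟩⟩
  · exact allIn_iff.2 fun t ht => (ZFSet.mem_sep.1 ht).1
  · refine allIn_iff.2 fun t ht => allIn_iff.2 fun t' ht' => ?_
    obtain ⟨-, h₂, h₃⟩ := ZFSet.mem_sep.1 ht
    obtain ⟨-, h₄, h₅⟩ := ZFSet.mem_sep.1 ht'
    have h₆ : Comparable L t t' := hS ⟨t, h₂⟩ h₃ ⟨t', h₄⟩ h₅
    exact h₆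
  · refine allIn_iff.2 fun x hx => ?_
    obtain ⟨α, hα, rfl⟩ := Ordinal.mem_toZFSet_iff.1 hx
    obtain ⟨t, ht, rfl⟩ := hS' α hα
    exact exIn_iff.2 ⟨t.1, ZFSet.mem_sep.2 ⟨t.2, t.2, ht⟩, hrel t⟩

end GapForcing

theorem mainTheorem4 (R : Type u) [Preorder R] (κ : Ordinal.{u})
    (hgap : ∃ δ : Cardinal.{u}, δ.ord < κ ∧ GapForcing.AdmitsGapAt R δ)
    (r : R) (hr : GapForcing.Forces r (GapForcing.weaklyCompact
      (GapForcing.BName.checkOrd κ : GapForcing.BName (GapForcing.RO R)))) :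
    GapForcing.weaklyCompact κ.toZFSet := by
  obtain ⟨δ, hδ, hgap⟩ := hgap
  have h : GapForcing.RO.of r ≤ GapForcing.weaklyCompact (GapForcing.BName.ck κ.toZFSet) :=
    (GapForcing.BName.ext_weaklyCompact (f := fun x => x)).congr
      (GapForcing.BName.checkOrd_eq_ck κ) (GapForcing.forces_iff.1 hr)
  have hin := GapForcing.BName.isInaccessible_of_forced (GapForcing.of_ne_bot r)
    (h.trans inf_le_left)
  exact ⟨hin, GapForcing.treeProperty_of_forced hδ hgap hin.1.1 (GapForcing.of_ne_bot r)
    (h.trans inf_le_right)⟩
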